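/- **Setting.** Fix a local energy scale $g$, $k\in\mathbb N$ and a range $d_H\in\mathbb N$. A *translation-invariant local interaction* assigns to every finite $X\subset\mathbb Z$ a self-adjoint operator $h_X$ on the qubits of $X$, such that $h_{X+a}$ is the translate of $h_X$, $\sum_{X\ni j}\|h_X\|\le g$ for every site $j$, $h_X=0$ if $|X|>k$, and $h_X=0$ if $X$ contains two sites at distance larger than $d_H$. For $L>2d_H$ let $H^{(L)}$ be the Hamiltonian on the periodic chain $\mathbb Z/L$ which is the sum of the terms $h_X$, one for each nonempty $X$ modulo translation by $L$, and let $U^{(L)}=e^{-iH^{(L)}\tau}$, $\tau\ge0$. For $L'>0$ and a site $j$ let $H^{(L',j)}$ be the sum of the $h_X$ with nonempty $X\subseteq\{j'\in\mathbb Z: |j-j'|\le L'/2\}$, regarded as an operator on $\mathbb Z/L$ when $L\ge L'+1$ (also for $L'=0$). Given a parametrized two-qubit unitary gate $V^{(2)}(p)$, $p\in P$, a depth $d$, parameters $\theta=(\theta_i,\theta_i')_{1\le i\le d}$ with $\theta_i,\theta'_i\in P$, and an even $L$, the translation-invariant brickwork ansatz with periodic boundary conditions is $$V^{(L)}(\theta)=\prod_{i=1}^d\Big[\Big(\prod_{k=1}^{L/2}V^{(2)}_{2k,2k+1}(\theta_i)\Big)\Big(\prod_{k=1}^{L/2}V^{(2)}_{2k-1,2k}(\theta'_i)\Big)\Big],\qquad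 L+1\equiv1 .$$ For unitaries $U,V$ on $L$ qubits, $C_{\rm HST}(U,V)=1-4^{-L}|\mathrm{Tr}[U^\dagger V]|^2$ and $C_{\rm LHST}(U,V)=\frac1L\sum_{j=1}^L\big(1-\mathrm{Tr}[\Pi_j\rho_{AB}(U,V)]\big)$, where $\rho_{AB}(U,V)=(U_A\otimes V_B^*)|\Phi_+\rangle\langle\Phi_+|(U_A\otimes V_B^*)^\dagger$, $|\Phi_+\rangle$ is the product over the sites $j$ of the Bell states $(|00\rangle+|11\rangle)/\sqrt2$ of the pairs $A_jB_j$, and $\Pi_j$ is the projection onto the Bell state of $A_jB_j$. For $\alpha\in[0,1]$ put $C_\alpha=\alpha C_{\rm HST}+(1-\alpha)C_{\rm LHST}$. **Theorem.** (i) There are a Lieb–Robinson velocity $v>0$ and a length $\xi>0$, depending only on $g,k,d_H$, such that for each $\tau\ge 0$ there is a constant $C$ with $$\|[U^{(L)\dagger}O_iU^{(L)},O_j]\|\le C\,e^{-(\mathrm{dist}(i,j)-v\tau)/\xi}$$ for all such interactions, all $L>2d_H$, all sites $i,j\in\mathbb Z/L$ and all one-site observables $O_i,O_j$ of norm $1$.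 Now let $v\ge0$, $\xi>0$, $\tau\ge0$, $C$ be any constants for which this inequality holds at the time $\tau$ (for all such interactions, sizes, sites and observables), and for $l_0\ge0$ put $L'=2(l_0+d_H+v\tau)$. (ii) There is a constant $C'\ge0$, independent of the interaction, of $l_0$ and of the sizes, such that $$\varepsilon_{\rm LR}=C'\int_{L'/2-d_H}^\infty e^{-(x-v\tau)/\xi}\,dx$$ satisfies $$\big\|U^{(L)\dagger}O_jU^{(L)}-e^{iH^{(L',j)}\tau}O_je^{-iH^{(L',j)}\tau}\big\|\le\varepsilon_{\rm LR}\qquad(*)$$ for all such interactions, all $l_0\ge0$, all $L\ge L'+1$, all sites $j$ and all one-site observables $O_j$ of norm $1$. (iii) Let an interaction as above, $l_0\ge0$ and $C'$ be such that $\varepsilon_{\rm LR}$ satisfies $(*)$ for this interaction and this $l_0$ (all $L\ge L'+1$, $j$, $O_j$). Let the depth be $d=L'/4+d'$ with $d'\ge0$, and let $\tilde L$ be the smallest even number larger than $2(l_0+d_H+v\tau)+2d'+1$. Let $\alpha\in[0,1]$ and let $\theta_{\rm opt}$ minimize $C_\alpha(U^{(\tilde L)},V^{(\tilde L)}(\theta))$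 over $\theta$. If $$C_{\rm LHST}(U^{(\tilde L)},V^{(\tilde L)}(\theta_{\rm opt}))<\varepsilon_{\rm LHST},\qquad C_{\rm HST}(U^{(\tilde L)},V^{(\tilde L)}(\theta_{\rm opt}))<\varepsilon_{\rm HST},$$ then for every even $L\ge\tilde L$ $$C_{\rm LHST}(U^{(L)},V^{(L)}(\theta_{\rm opt}))\le\varepsilon_{\rm LHST}+\tfrac32\varepsilon_{\rm LR},\qquad C_{\rm HST}(U^{(L)},V^{(L)}(\theta_{\rm opt}))\le L\left(\varepsilon_{\rm HST}+\tfrac32\varepsilon_{\rm LR}\right).$$ -/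

import Mathlib

open scoped Kronecker

namespace LVQC

noncomputable section

/-! ### Qubits and operators

The qubits of a system are labelled by a finite type `ι`; the computational basis is `ι → Fin 2`,
and operators are matrices in this basis. -/

/-- The algebra of operators on the qubits `ι`. -/
abbrev Op (ι : Type*) := Matrix (ι → Fin 2) (ι → Fin 2) ℂ

/-- The operator norm of a matrix acting on the Euclidean (Hilbert) space. -/
def opNorm {n : Type*} [Fintype n] [DecidableEq n] (A : Matrix n n ℂ) : ℝ :=
  ‖Matrix.toEuclideanCLM (n := n) (𝕜 := ℂ) A‖

/-- The operator `A ⊗ I`: the operator `A` on the qubits `κ` acts on the qubits `f x`, `x : κ`,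
of a larger system `ι` (`f` injective), and trivially on all the others. -/
def embed {κ ι : Type*} (f : κ → ι) (A : Op κ) : Op ι :=
  open Classical in
  Matrix.of fun s t => if ∀ i, i ∉ Set.range f → s i = t i then A (s ∘ f) (t ∘ f) else 0

/-- A one-qubit operator acting on the site `j`. -/
def single {ι : Type*} (j : ι) (O : Op Unit) : Op ι := embed (fun _ => j) O

/-- `O` is a normalized one-qubit observable. -/
def IsNormalizedObservable (O : Op Unit) : Prop := O.IsHermitian ∧ opNorm O = 1

/-- The time evolution operator `exp (-i H τ)`. -/
def evolution {n : Type*} [Fintype n] [DecidableEq n] (H : Matrix n n ℂ) (τ : ℝ) : Matrix n n ℂ :=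
  NormedSpace.exp ((-(Complex.I * (τ : ℂ))) • H)

/-! ### Cost functions -/

section Cost

variable {ι : Type*} [Fintype ι] [DecidableEq ι]

/-- The state `⨂ⱼ (|00⟩ + |11⟩)/√2` of the `2L` qubits `A ∪ B`, as a vector. -/
def bellState (ι : Type*) [Fintype ι] : (ι → Fin 2) × (ι → Fin 2) → ℂ :=
  fun p => ∏ j, (if p.1 j = p.2 j then (1 / (Real.sqrt 2 : ℂ)) else 0)

/-- `ρ_AB(U, V) = (U_A ⊗ V*_B) |Φ₊⟩⟨Φ₊| (U_A ⊗ V*_B)†`. -/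
def rhoAB (U V : Op ι) :
    Matrix ((ι → Fin 2) × (ι → Fin 2)) ((ι → Fin 2) × (ι → Fin 2)) ℂ :=
  (U ⊗ₖ V.map (starRingEnd ℂ)) * Matrix.vecMulVec (bellState ι) (star (bellState ι)) *
    (U ⊗ₖ V.map (starRingEnd ℂ)).conjTranspose

/-- The projection `Π_j` onto the Bell state of the pair `A_j B_j`, tensored with the identity on
the other qubits. -/
def bellProj (j : ι) :
    Matrix ((ι → Fin 2) × (ι → Fin 2)) ((ι → Fin 2) × (ι → Fin 2)) ℂ :=
  Matrix.of fun p q =>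
    if ∀ i, i ≠ j → p.1 i = q.1 i ∧ p.2 i = q.2 i then
      (if p.1 j = p.2 j then (1 / (Real.sqrt 2 : ℂ)) else 0) *
        (if q.1 j = q.2 j then (1 / (Real.sqrt 2 : ℂ)) else 0)
    else 0

/-- The global cost function `C_HST(U, V) = 1 - 4^{-L} |Tr[U† V]|²`. -/
def costHST (U V : Op ι) : ℝ :=
  1 - 1 / 4 ^ Fintype.card ι * ‖(U.conjTranspose * V).trace‖ ^ 2

/-- The local cost function at the site `j`: `1 - Tr[Π_j ρ_AB(U, V)]` (the trace is real). -/
def costLHSTAt (j : ι) (U V : Op ι) : ℝ :=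
  1 - ((bellProj j * rhoAB U V).trace).re

/-- The local cost function `C_LHST`, the average over all sites. -/
def costLHST (U V : Op ι) : ℝ :=
  1 / (Fintype.card ι : ℝ) * ∑ j, costLHSTAt j U V

/-- The combined cost function `C_α`. -/
def costAlpha (α : ℝ) (U V : Op ι) : ℝ :=
  α * costHST U V + (1 - α) * costLHST U V

end Cost

/-! ### Translation-invariant local Hamiltonians with periodic boundary conditions -/

/-- A translation-invariant interaction on the infinite chain `ℤ`: a self-adjoint term `h_X` acting
on the qubits of `X`, for every finite set `X` of sites, with `h_{X + a}` the translate of `h_X`.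
It determines the Hamiltonians of all sizes. -/
structure Interaction where
  h : (X : Finset ℤ) → Op X
  hermitian : ∀ X, (h X).IsHermitian
  translate : ∀ (X : Finset ℤ) (a : ℤ) (s t : (X.map (addRightEmbedding a) : Finset ℤ) → Fin 2),
    h (X.map (addRightEmbedding a)) s t =
      h X (fun x => s ⟨x.1 + a, Finset.mem_map_of_mem _ x.2⟩)
        (fun x => t ⟨x.1 + a, Finset.mem_map_of_mem _ x.2⟩)

/-- Extensiveness with local energy scale `g`, at most `k`-body terms, interaction range `dH`. -/
structure Interaction.IsLocal (Φ : Interaction) (g : ℝ) (k dH : ℕ) : Prop where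
  /-- `∑_{X ∋ j} ‖h_X‖ ≤ g`; stated for all finite partial sums. -/
  extensive : ∀ (j : ℤ) (S : Finset (Finset ℤ)), (∀ X ∈ S, j ∈ X) →
    ∑ X ∈ S, opNorm (Φ.h X) ≤ g
  body : ∀ X : Finset ℤ, k < X.card → Φ.h X = 0
  range : ∀ X : Finset ℤ, (∃ x ∈ X, ∃ y ∈ X, (dH : ℤ) < |x - y|) → Φ.h X = 0

/-- The Hamiltonian on the ring `ZMod L`, for an interaction of range `dH` (`dH < L`): the sum of the
terms `h_X`, one for each nonempty `X` modulo translations by `L` (the one whose leftmost site lies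
in `{0, …, L - 1}`), acting on the sites of `X` modulo `L`. -/
def Interaction.hamPBC (Φ : Interaction) (dH L : ℕ) : Op (ZMod L) :=
  open Classical in
  ∑ X ∈ (Finset.Ico (0 : ℤ) (L + dH)).powerset with
      ∃ a : ℤ, a ∈ X ∧ a < (L : ℤ) ∧ ∀ x ∈ X, a ≤ x,
    embed (fun x : X => ((x : ℤ) : ZMod L)) (Φ.h X)

/-- The restricted Hamiltonian around the site `j`: the sum of the terms `h_X` with `X` contained in
the segment `{j' | |j - j'| ≤ L' / 2}`, acting on the ring `ZMod L` (the segment has to fit into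
the ring). -/
def Interaction.hamRestricted (Φ : Interaction) (L : ℕ) (L' : ℝ) (j : ℤ) : Op (ZMod L) :=
  ∑ X ∈ (Finset.Icc ⌈(j : ℝ) - L' / 2⌉ ⌊(j : ℝ) + L' / 2⌋).powerset with X.Nonempty,
    embed (fun x : X => ((x : ℤ) : ZMod L)) (Φ.h X)

/-- The target `U_PBC^{(L)} = exp (-i H_PBC^{(L)} τ)`. -/
def Interaction.target (Φ : Interaction) (dH : ℕ) (τ : ℝ) (L : ℕ) [NeZero L] : Op (ZMod L) :=
  evolution (Φ.hamPBC dH L) τ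

/-! ### Lieb-Robinson bounds -/

/-- The distance of two sites on the ring. -/
def ringDist {L : ℕ} (i j : ZMod L) : ℕ := (i - j).valMinAbs.natAbs

/-- The Lieb-Robinson bound at time `τ` with velocity `v`, length `ξ` and prefactor `C`, for all
translation-invariant Hamiltonians (of all sizes) with the parameters `g`, `k`, `dH`:
`‖[U(τ)† O_i U(τ), O'_j]‖ ≤ C exp (-(dist(i, j) - v τ) / ξ)`. -/
def LiebRobinsonBound (g : ℝ) (k dH : ℕ) (v ξ τ C : ℝ) : Prop :=
  ∀ Φ : Interaction, Φ.IsLocal g k dH → ∀ (L : ℕ) [NeZero L], 2 * dH < L →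
    ∀ (i j : ZMod L) (O O' : Op Unit), IsNormalizedObservable O → IsNormalizedObservable O' →
      opNorm ((Φ.target dH τ L).conjTranspose * single i O * Φ.target dH τ L * single j O' -
          single j O' * ((Φ.target dH τ L).conjTranspose * single i O * Φ.target dH τ L)) ≤
        C * Real.exp (-((ringDist i j : ℝ) - v * τ) / ξ)

/-- `ε` bounds the error caused by the restriction of the Hamiltonian to the `L'`-size segment
around a site, for the time evolution of one-site observables, at all sizes into which the segment
fits:
`‖U(τ)† O_j U(τ) - exp (i H^{(L',j)} τ) O_j exp (-i H^{(L',j)} τ)‖ ≤ ε`. -/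
def Interaction.RestrictionErrorLE (Φ : Interaction) (dH : ℕ) (τ L' ε : ℝ) : Prop :=
  ∀ (L : ℕ) [NeZero L], L' + 1 ≤ L → ∀ (j : ℤ) (O : Op Unit), IsNormalizedObservable O →
    opNorm ((Φ.target dH τ L).conjTranspose * single (j : ZMod L) O * Φ.target dH τ L -
        (evolution (Φ.hamRestricted L L' j) τ).conjTranspose * single (j : ZMod L) O *
          evolution (Φ.hamRestricted L L' j) τ) ≤ ε

/-- The restriction size `L' = 2 (l₀ + d_H + v τ)`. -/
def restrictionSize (dH : ℕ) (v τ l₀ : ℝ) : ℝ := 2 * (l₀ + dH + v * τ)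

/-- `ε_LR = C' ∫_{L'/2 - d_H}^∞ exp (-(x - v τ) / ξ) dx`. -/
def epsLR (dH : ℕ) (v ξ τ l₀ C' : ℝ) : ℝ :=
  C' * ∫ x in Set.Ioi (restrictionSize dH v τ l₀ / 2 - dH), Real.exp (-(x - v * τ) / ξ)

/-! ### The brickwork ansatz -/

/-- A unitary two-qubit gate. -/
abbrev Gate := Matrix.unitaryGroup (Fin 2 → Fin 2) ℂ

/-- The two-qubit gate `G` acting on the sites `j` and `j + 1` of the ring. -/
def gateAt {L : ℕ} (j : ZMod L) (G : Gate) : Op (ZMod L) :=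
  embed ![j, j + 1] (G : Op (Fin 2))

/-- The translation-invariant brickwork ansatz of depth `d` with periodic boundary conditions
(`L` even, sites `1, …, L` with `L + 1 = 1`):
`V(θ) = ∏_{i=1}^d [(∏_k V_{2k,2k+1}(θ_i)) (∏_k V_{2k-1,2k}(θ'_i))]`, with `k = 1, …, L / 2`,
where `θ i = (θ_i, θ'_i)` and `V p` is the two-qubit gate with the parameter `p`. -/
def ansatz {P : Type*} (V : P → Gate) {d : ℕ} (θ : Fin d → P × P) (L : ℕ) [NeZero L] :
    Op (ZMod L) :=
  (List.ofFn fun i : Fin d =>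
    (List.ofFn fun k : Fin (L / 2) =>
      gateAt ((2 * (k.1 + 1) : ℕ) : ZMod L) (V (θ i).1)).prod *
    (List.ofFn fun k : Fin (L / 2) =>
      gateAt ((2 * k.1 + 1 : ℕ) : ZMod L) (V (θ i).2)).prod).prod

end

end LVQC

open LVQC

/-!
The evolution of a one-site observable `O` hardly changes when only the terms inside a window of the
chain are kept. Let `α^r` be the Heisenberg evolution with the terms of the window of
radius `r`. Enlarging the window from `r` to any larger region adds terms that cross its ends, of
total norm at most `2 d_H g` since the chain is one-dimensional, and terms disjoint from it, which
commute with `α^r(O)`. The terms crossing the ends commute with `α^{r'}(O)` when `r' + d_H ≤ r`, so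
that in Duhamel's formula only their commutator with `α^r(O) - α^{r'}(O)` is left; every step gains
a time integral (`norm_heisenberg_sub_le_of_step`), and iterating gives an error
`2 (4 d_H g τ)^n / n!` for a window of radius at least `n (d_H + 1)`
(`norm_heisenberg_sub_window_le`). This decays faster than every exponential. Hence it implies the
Lieb-Robinson bound, because an operator of a window commutes with all observables outside
(`liebRobinsonBound`), and it bounds the restriction error by `ε_LR` for every length `ξ > 0`
(`restrictionErrorLE`).

For the compilation, the projection onto the Bell state is the average of `P ⊗ P*` over the identity
and the Pauli matrices, so the local cost at `j` is
`1 - (1/4) ∑_P 2^{-L} Tr[(U† P_j U) (V† P_j V)]` (`costLHSTAt_eq`). Replacing `U† P_j U` by the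
evolution in the window of size `L'` costs at most `(3/4) ε_LR`, the identity being free of error.
What remains does not depend on the size of the ring (`trace_mul_conj_circuit_eq`): in the trace the
first layers of the circuit act on `P_j` and the last ones on the restricted observable; each layer
increases the radius of a support by one, so all supports lie in a window of radius about
`(L'/2 + 2 d) / 2`, which fits into the ring of size `L̃`. Doing so on both rings gives
`(3/2) ε_LR`. Finally the Bell measurement of all the pairs has a probability distribution, for
which `C_HST` is the probability that some outcome is wrong and `C_LHST` the probability that a given
one is, averaged over the sites; therefore `C_LHST ≤ C_HST ≤ L C_LHST` (`costLHST_le_costHST`,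
`costHST_le_card_mul_costLHST`).
-/

namespace LVQC

noncomputable section

open scoped Matrix.Norms.L2Operator Nat

/-! ### The embedding of local operators -/

section Embed

variable {κ κ' ι : Type*}

theorem embed_apply (f : κ → ι) (A : Op κ) (s t : ι → Fin 2)
    [Decidable (∀ i, i ∉ Set.range f → s i = t i)] :
    embed f A s t = if ∀ i, i ∉ Set.range f → s i = t i then A (s ∘ f) (t ∘ f) else 0 := by
  simp only [embed, Matrix.of_apply]
  congr

theorem embed_add (f : κ → ι) (A B : Op κ) : embed f (A + B) = embed f A + embed f B := by
  classical
  ext s t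
  simp only [embed_apply, Matrix.add_apply]
  split_ifs <;> simp

theorem embed_smul (f : κ → ι) (c : ℂ) (A : Op κ) : embed f (c • A) = c • embed f A := by
  classical
  ext s t
  simp only [embed_apply, Matrix.smul_apply]
  split_ifs <;> simp

@[simp]
theorem embed_zero (f : κ → ι) : embed f (0 : Op κ) = 0 := by
  simpa using embed_smul f 0 0

theorem embed_conjTranspose (f : κ → ι) (A : Op κ) :
    embed f A.conjTranspose = (embed f A).conjTranspose := by
  classical
  ext s t
  simp only [embed_apply, Matrix.conjTranspose_apply, apply_ite star, star_zero]
  exact if_congr (by simp only [eq_comm]) rfl rfl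

theorem embed_one [DecidableEq κ] [Fintype κ] [DecidableEq ι] [Fintype ι] (f : κ → ι) :
    embed f (1 : Op κ) = 1 := by
  classical
  ext s t
  simp only [embed_apply, Matrix.one_apply]
  by_cases h : s = t
  · simp [h]
  · rw [if_neg h]
    split_ifs with h1 h2
    · exact absurd (funext fun i => by
        by_cases hi : i ∈ Set.range f
        · obtain ⟨k, rfl⟩ := hi
          exact congrFun h2 k
        · exact h1 i hi) h
    · rfl
    · rfl

theorem embed_embed {f : κ → ι} (hf : f.Injective) (g : κ' → κ) (A : Op κ') :
    embed f (embed g A) = embed (f ∘ g) A := by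
  classical
  ext s t
  simp only [embed_apply, ← ite_and, Function.comp_assoc]
  refine if_congr ⟨fun h i hi => ?_, fun h => ⟨fun i hi => h i ?_, fun k hk => h _ ?_⟩⟩ rfl rfl
  · by_cases hi' : i ∈ Set.range f
    · obtain ⟨k, rfl⟩ := hi'
      exact h.2 k fun ⟨l, hl⟩ => hi ⟨l, by simp [hl]⟩
    · exact h.1 i hi'
  · rintro ⟨l, rfl⟩
    exact hi ⟨g l, rfl⟩
  · rintro ⟨l, hl⟩
    exact hk ⟨l, hf hl⟩

theorem embed_equiv (e : κ' ≃ κ) (f : κ → ι) (A : Op κ) (B : Op κ')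
    (h : ∀ s t, A s t = B (s ∘ e) (t ∘ e)) : embed f A = embed (f ∘ e) B := by
  classical
  ext s t
  simp only [embed_apply, EquivLike.range_comp, h]
  rfl

variable [Fintype κ] [Fintype κ'] [Fintype ι] [DecidableEq ι]

theorem embed_mul [DecidableEq κ] {f : κ → ι} (hf : f.Injective) (A B : Op κ) :
    embed f (A * B) = embed f A * embed f B := by
  classical
  ext s t
  rw [embed_apply, Matrix.mul_apply, Matrix.mul_apply]
  have hext : ∀ (v : κ → Fin 2), Function.extend f v s ∘ f = v := fun v =>
    funext fun k => hf.extend_apply _ _ _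
  have hoff : ∀ (v : κ → Fin 2) (i : ι), i ∉ Set.range f → Function.extend f v s i = s i :=
    fun v i hi => Function.extend_apply' _ _ _ fun ⟨k, hk⟩ => hi ⟨k, hk⟩
  split_ifs with h
  · refine Finset.sum_of_injOn (fun v => Function.extend f v s) ?_ (by simp) ?_ ?_
    · intro v _ w _ hvw
      rw [← hext v, ← hext w]
      exact congrArg (· ∘ f) hvw
    · intro u _ hu
      rw [embed_apply f A, if_neg, zero_mul]
      intro h'
      refine hu ⟨u ∘ f, by simp, funext fun i => ?_⟩
      by_cases hi : i ∈ Set.range f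
      · obtain ⟨k, rfl⟩ := hi
        exact hf.extend_apply _ _ _
      · rw [← h' i hi]
        exact hoff _ i hi
    · intro v _
      rw [embed_apply f A, embed_apply f B, hext, if_pos fun i hi => (hoff v i hi).symm,
        if_pos fun i hi => (hoff v i hi).trans (h i hi)]
  · symm
    refine Finset.sum_eq_zero fun u _ => ?_
    by_cases hu : ∀ i, i ∉ Set.range f → s i = u i
    · rw [embed_apply f B, if_neg, mul_zero]
      exact fun h' => h fun i hi => (hu i hi).trans (h' i hi)
    · rw [embed_apply f A, if_neg hu, zero_mul]

omit [Fintype κ] [Fintype κ'] in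
theorem embed_mul_embed_apply {f : κ → ι} {g : κ' → ι}
    (hfg : ∀ k k', f k ≠ g k') (A : Op κ) (B : Op κ') (s t : ι → Fin 2)
    [Decidable (∀ i, i ∉ Set.range f → i ∉ Set.range g → s i = t i)] :
    (embed f A * embed g B) s t =
      if ∀ i, i ∉ Set.range f → i ∉ Set.range g → s i = t i then
        A (s ∘ f) (t ∘ f) * B (s ∘ g) (t ∘ g) else 0 := by
  classical
  -- the only intermediate configuration that contributes
  set u : ι → Fin 2 := fun i => if i ∈ Set.range f then t i else s i with hu
  have hf : ∀ k, u (f k) = t (f k) := fun k => if_pos ⟨k, rfl⟩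
  have hg : ∀ k, u (g k) = s (g k) := fun k => if_neg fun ⟨l, hl⟩ => hfg l k hl
  rw [Matrix.mul_apply, Finset.sum_eq_single u]
  · rw [embed_apply, embed_apply, if_pos fun i hi => (if_neg hi).symm]
    have h1 : u ∘ f = t ∘ f := funext hf
    have h2 : u ∘ g = s ∘ g := funext hg
    rw [h1, h2, mul_ite, mul_zero]
    refine if_congr ⟨fun h i hi hi' => ?_, fun h i hi => ?_⟩ rfl rfl
    · rw [← h i hi', hu]
      exact (if_neg hi).symm
    · by_cases hi' : i ∈ Set.range f
      · exact if_pos hi'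
      · rw [← h i hi' hi]
        exact if_neg hi'
  · intro w _ hw
    by_contra hne
    rw [embed_apply, embed_apply] at hne
    have h1 : ∀ i, i ∉ Set.range f → s i = w i := by
      by_contra h
      rw [if_neg h, zero_mul] at hne
      exact hne rfl
    have h2 : ∀ i, i ∉ Set.range g → w i = t i := by
      by_contra h
      rw [if_neg h, mul_zero] at hne
      exact hne rfl
    refine hw (funext fun i => ?_)
    by_cases hi : i ∈ Set.range f
    · obtain ⟨k, rfl⟩ := hi
      rw [hf]
      exact h2 _ fun ⟨l, hl⟩ => hfg k l hl.symm
    · rw [← h1 i hi]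
      exact (if_neg hi).symm
  · simp

omit [Fintype κ] [Fintype κ'] in
/-- Operators on disjoint sets of qubits commute. -/
theorem commute_embed {f : κ → ι} {g : κ' → ι} (hfg : ∀ k k', f k ≠ g k') (A : Op κ) (B : Op κ') :
    Commute (embed f A) (embed g B) := by
  classical
  ext s t
  rw [embed_mul_embed_apply hfg, embed_mul_embed_apply fun k k' => (hfg k' k).symm]
  refine if_congr ⟨fun h i h1 h2 => h i h2 h1, fun h i h1 h2 => h i h2 h1⟩ (mul_comm _ _) rfl

/-- The embedding along an injection as a homomorphism of star algebras. -/
def embedHom [DecidableEq κ] {f : κ → ι} (hf : f.Injective) : Op κ →⋆ₐ[ℂ] Op ι where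
  toFun := embed f
  map_one' := embed_one f
  map_mul' := embed_mul hf
  map_zero' := embed_zero f
  map_add' := embed_add f
  commutes' c := by
    rw [Algebra.algebraMap_eq_smul_one, embed_smul, embed_one, Algebra.algebraMap_eq_smul_one]
  map_star' := embed_conjTranspose f

theorem embedHom_apply [DecidableEq κ] {f : κ → ι} (hf : f.Injective) (A : Op κ) :
    embedHom hf A = embed f A := rfl

omit [Fintype κ] [Fintype ι] [DecidableEq ι] in
theorem embed_sum {f : κ → ι} {α : Type*} (S : Finset α) (A : α → Op κ) :
    embed f (∑ x ∈ S, A x) = ∑ x ∈ S, embed f (A x) := by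
  classical
  induction S using Finset.induction_on with
  | empty => simp
  | insert a S ha ih => rw [Finset.sum_insert ha, Finset.sum_insert ha, embed_add, ih]

/-- The trace of `A ⊗ I`, with the dimension of the trivial factor. -/
theorem trace_embed [DecidableEq κ] {f : κ → ι} (hf : f.Injective) (A : Op κ) :
    (embed f A).trace / 2 ^ Fintype.card ι = A.trace / 2 ^ Fintype.card κ := by
  classical
  let e : (κ ⊕ ((Set.range f)ᶜ : Set ι)) ≃ ι :=
    ((Equiv.ofInjective f hf).sumCongr (Equiv.refl _)).trans (Equiv.Set.sumCompl _)
  let E : (κ → Fin 2) × (((Set.range f)ᶜ : Set ι) → Fin 2) ≃ (ι → Fin 2) :=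
    (Equiv.sumArrowEquivProdArrow _ _ _).symm.trans (Equiv.arrowCongr e (Equiv.refl _))
  have hE : ∀ p, E p ∘ f = p.1 := by
    intro p
    funext k
    have : e.symm (f k) = Sum.inl k := by
      rw [Equiv.symm_apply_eq]
      rfl
    simp [E, Equiv.arrowCongr, this, Equiv.sumArrowEquivProdArrow]
  have hcard : Fintype.card ι = Fintype.card κ + Fintype.card ((Set.range f)ᶜ : Set ι) := by
    rw [← Fintype.card_sum]
    exact (Fintype.card_congr e).symm
  have : (embed f A).trace = A.trace * 2 ^ Fintype.card ((Set.range f)ᶜ : Set ι) := by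
    simp only [Matrix.trace, Matrix.diag, embed_apply]
    rw [← E.sum_comp]
    simp only [hE, implies_true, if_true]
    rw [Fintype.sum_prod_type, Finset.sum_mul]
    refine Finset.sum_congr rfl fun s _ => ?_
    simp [mul_comm]
  rw [this, hcard, pow_add]
  have h2 : (2 : ℂ) ^ Fintype.card ((Set.range f)ᶜ : Set ι) ≠ 0 := pow_ne_zero _ two_ne_zero
  field_simp

theorem opNorm_eq_norm {n : Type*} [Fintype n] [DecidableEq n] (A : Matrix n n ℂ) :
    opNorm A = ‖A‖ := rfl

theorem norm_embed_le [DecidableEq κ] {f : κ → ι} (hf : f.Injective) (A : Op κ) :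
    ‖embed f A‖ ≤ ‖A‖ := by
  let _ : CStarAlgebra (Op κ) := {}
  let _ : CStarAlgebra (Op ι) := {}
  exact NonUnitalStarAlgHom.norm_apply_le (embedHom hf) A

theorem evolution_embed [DecidableEq κ] {f : κ → ι} (hf : f.Injective) (H : Op κ) (τ : ℝ) :
    evolution (embed f H) τ = embed f (evolution H τ) := by
  let _ : NormedAlgebra ℚ (Op κ) := NormedAlgebra.restrictScalars ℚ ℂ (Op κ)
  have hc : Continuous (embedHom hf) := by
    have : Continuous (embedHom hf).toAlgHom.toLinearMap :=
      LinearMap.continuous_of_finiteDimensional _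
    exact this
  have := NormedSpace.map_exp (embedHom hf) hc ((-(Complex.I * (τ : ℂ))) • H)
  rw [embedHom_apply, embedHom_apply, embed_smul] at this
  exact this.symm

end Embed

/-! ### One-site operators -/

section Single

variable {ι : Type*} [Fintype ι] [DecidableEq ι]

omit [Fintype ι] [DecidableEq ι] in
theorem injective_const_unit (j : ι) : Function.Injective (fun _ : Unit => j) :=
  fun _ _ _ => rfl

theorem norm_single_le (j : ι) (O : Op Unit) : ‖single j O‖ ≤ ‖O‖ :=
  norm_embed_le (injective_const_unit j) O

omit [Fintype ι] [DecidableEq ι] in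
theorem single_conjTranspose (j : ι) (O : Op Unit) :
    (single j O).conjTranspose = single j O.conjTranspose :=
  (embed_conjTranspose _ _).symm

end Single

/-! ### Unitary evolutions -/

section Evolution

variable {n : Type*} [Fintype n] [DecidableEq n]

theorem evolution_eq_exp_smul (H : Matrix n n ℂ) (t : ℝ) :
    evolution H t = NormedSpace.exp (t • (-(Complex.I • H))) := by
  unfold evolution
  congr 1
  rw [← Complex.coe_smul, ← neg_smul, smul_smul]
  congr 1
  ring

theorem evolution_conjTranspose {H : Matrix n n ℂ} (hH : H.IsHermitian) (t : ℝ) :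
    (evolution H t).conjTranspose = evolution H (-t) := by
  unfold evolution
  rw [← Matrix.exp_conjTranspose, Matrix.conjTranspose_smul, hH.eq]
  congr 2
  simp

theorem evolution_mem_unitary {H : Matrix n n ℂ} (hH : H.IsHermitian) (t : ℝ) :
    evolution H t ∈ unitary (Matrix n n ℂ) := by
  have h : ∀ s : ℝ, evolution H (-s) * evolution H s = 1 := by
    intro s
    rw [evolution_eq_exp_smul, evolution_eq_exp_smul, ← Matrix.exp_add_of_commute]
    · simp
    · exact ((Commute.refl _).smul_left _).smul_right _
  rw [Unitary.mem_iff, Matrix.star_eq_conjTranspose, evolution_conjTranspose hH]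
  exact ⟨h t, by simpa using h (-t)⟩

theorem norm_le_one_of_mem_unitary {U : Matrix n n ℂ} (hU : U ∈ unitary (Matrix n n ℂ)) :
    ‖U‖ ≤ 1 := by
  rcases subsingleton_or_nontrivial (Matrix n n ℂ) with h | h
  · rw [Subsingleton.elim U 0, norm_zero]
    exact zero_le_one
  · exact (CStarRing.norm_of_mem_unitary hU).le

theorem norm_conj_le {U : Matrix n n ℂ} (hU : U ∈ unitary (Matrix n n ℂ)) (A : Matrix n n ℂ) :
    ‖U.conjTranspose * A * U‖ ≤ ‖A‖ := by
  have h1 := norm_le_one_of_mem_unitary hU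
  have h2 : ‖U.conjTranspose‖ ≤ 1 := by rwa [Matrix.l2_opNorm_conjTranspose]
  calc ‖U.conjTranspose * A * U‖ ≤ ‖U.conjTranspose‖ * ‖A‖ * ‖U‖ := norm_mul₃_le
    _ ≤ 1 * ‖A‖ * 1 := by gcongr
    _ = ‖A‖ := by ring

end Evolution

/-! ### Comparison of two Heisenberg evolutions -/

section Abstract

variable {𝔸 : Type*} [NormedRing 𝔸] [NormedAlgebra ℝ 𝔸]

/-- The Heisenberg evolution `exp (-t X) A exp (t X)` of `A`; the generator `X` is `-i H` for a
Hamiltonian `H`. -/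
def heisenberg (X A : 𝔸) (t : ℝ) : 𝔸 :=
  NormedSpace.exp (-t • X) * A * NormedSpace.exp (t • X)

variable [CompleteSpace 𝔸]

theorem exp_neg_smul_mul_exp_smul (X : 𝔸) (t : ℝ) :
    NormedSpace.exp (-t • X) * NormedSpace.exp (t • X) = 1 := by
  let _ : NormedAlgebra ℚ 𝔸 := NormedAlgebra.restrictScalars ℚ ℝ 𝔸
  rw [← NormedSpace.exp_add_of_commute (((Commute.refl X).smul_left _).smul_right _)]
  simp

theorem hasDerivAt_heisenberg (X A : 𝔸) (t : ℝ) :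
    HasDerivAt (heisenberg X A) (heisenberg X A t * X - X * heisenberg X A t) t := by
  have h1 : HasDerivAt (fun s : ℝ => NormedSpace.exp (s • X)) (NormedSpace.exp (t • X) * X) t :=
    hasDerivAt_exp_smul_const X t
  have h2 : HasDerivAt (fun s : ℝ => NormedSpace.exp (-s • X))
      (-(X * NormedSpace.exp (-t • X))) t := by
    have := (hasDerivAt_exp_smul_const' (𝕂 := ℝ) X (-t)).scomp t (hasDerivAt_neg t)
    simpa [Function.comp_def] using this
  have := (h2.mul_const A).mul h1
  refine this.congr_deriv ?_
  simp only [heisenberg]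
  noncomm_ring

omit [CompleteSpace 𝔸] in
theorem commute_heisenberg [T2Space 𝔸] {X A F : 𝔸} (hX : Commute F X) (hA : Commute F A) (t : ℝ) :
    Commute F (heisenberg X A t) :=
  (((hX.smul_right _).exp_right).mul_right hA).mul_right (hX.smul_right _).exp_right

/-- One step of the Lieb-Robinson iteration. The generator `G` extends `K` by a boundary part `E`,
which does not interact with the evolution of `A` under the still smaller generator `K'`, and by a
remote part `F`, which does not interact with that under `K`. By Duhamel's formula only the
commutator of `E` with the difference of the two smaller evolutions contributes to the error, so
that one time integration is gained. -/
theorem norm_heisenberg_sub_le_of_step {G K K' E F A : 𝔸}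
    (hG : ∀ t : ℝ, ‖NormedSpace.exp (t • G)‖ ≤ 1)
    (hdec : G = K + E + F) (hFK : Commute F K) (hFA : Commute F A)
    (hEK : Commute E K') (hEA : Commute E A) {b c : ℝ} (hE : ‖E‖ ≤ b) {n : ℕ}
    (h : ∀ t : ℝ, 0 ≤ t → ‖heisenberg K A t - heisenberg K' A t‖ ≤ c * (t ^ n / n !)) :
    ∀ t : ℝ, 0 ≤ t →
      ‖heisenberg G A t - heisenberg K A t‖ ≤ 2 * b * c * (t ^ (n + 1) / (n + 1)!) := by
  intro t ht
  have hb : 0 ≤ b := (norm_nonneg _).trans hE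
  -- the evolution under `K`, followed by the backward evolution under `G`
  set f : ℝ → 𝔸 := fun s =>
    NormedSpace.exp (s • G) * heisenberg K A s * NormedSpace.exp (-s • G) - A with hf
  set f' : ℝ → 𝔸 := fun s => NormedSpace.exp (s • G) *
    (E * (heisenberg K A s - heisenberg K' A s) -
      (heisenberg K A s - heisenberg K' A s) * E) * NormedSpace.exp (-s • G) with hf'
  have hderiv : ∀ s, HasDerivAt f (f' s) s := by
    intro s
    have h1 : HasDerivAt (fun s : ℝ => NormedSpace.exp (s • G)) (NormedSpace.exp (s • G) * G) s :=
      hasDerivAt_exp_smul_const G s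
    have h2 : HasDerivAt (fun s : ℝ => NormedSpace.exp (-s • G))
        (-(G * NormedSpace.exp (-s • G))) s := by
      have := (hasDerivAt_exp_smul_const' (𝕂 := ℝ) G (-s)).scomp s (hasDerivAt_neg s)
      simpa [Function.comp_def] using this
    refine (((h1.mul (hasDerivAt_heisenberg K A s)).mul h2).sub_const A).congr_deriv ?_
    have hF : F * heisenberg K A s = heisenberg K A s * F := commute_heisenberg hFK hFA s
    have hE' : E * heisenberg K' A s = heisenberg K' A s * E := commute_heisenberg hEK hEA s
    have key : E * (heisenberg K A s - heisenberg K' A s) -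
        (heisenberg K A s - heisenberg K' A s) * E =
        G * heisenberg K A s - heisenberg K A s * G +
          (heisenberg K A s * K - K * heisenberg K A s) := by
      rw [hdec, mul_sub, sub_mul, hE', add_mul, add_mul, mul_add, mul_add, hF]
      abel
    rw [hf']
    simp only [Pi.mul_apply]
    rw [key]
    noncomm_ring
  have hbound : ∀ s ∈ Set.Ico 0 t, ‖f' s‖ ≤ 2 * b * c * (s ^ n / n !) := by
    intro s hs
    have hδ := h s hs.1
    set δ := heisenberg K A s - heisenberg K' A s
    have h1 : ‖E * δ - δ * E‖ ≤ 2 * b * (c * (s ^ n / n !)) := by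
      calc ‖E * δ - δ * E‖ ≤ ‖E‖ * ‖δ‖ + ‖δ‖ * ‖E‖ :=
            (norm_sub_le _ _).trans (add_le_add (norm_mul_le _ _) (norm_mul_le _ _))
        _ = 2 * ‖E‖ * ‖δ‖ := by ring
        _ ≤ 2 * b * (c * (s ^ n / n !)) := by gcongr
    calc ‖f' s‖ ≤ ‖NormedSpace.exp (s • G)‖ * ‖E * δ - δ * E‖ * ‖NormedSpace.exp (-s • G)‖ :=
          norm_mul₃_le
      _ ≤ 1 * (2 * b * (c * (s ^ n / n !))) * 1 := by
          gcongr
          · exact (norm_nonneg _).trans (h1.trans_eq (one_mul _).symm)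
          · exact hG s
          · exact hG (-s)
      _ = 2 * b * c * (s ^ n / n !) := by ring
  have hB : ∀ s : ℝ, HasDerivAt (fun s : ℝ => 2 * b * c * (s ^ (n + 1) / (n + 1)!))
      (2 * b * c * (s ^ n / n !)) s := by
    intro s
    refine (((hasDerivAt_pow (n + 1) s).div_const _).const_mul _).congr_deriv ?_
    rw [Nat.factorial_succ]
    push_cast
    have : (n ! : ℝ) ≠ 0 := by positivity
    field_simp
  have hft := image_norm_le_of_norm_deriv_right_le_deriv_boundary (f := f) (f' := f')
    (a := 0) (b := t)
    (fun s _ => (hderiv s).continuousAt.continuousWithinAt)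
    (fun s _ => (hderiv s).hasDerivWithinAt) (by simp [hf, heisenberg]) hB hbound ⟨ht, le_rfl⟩
  have hrew : heisenberg G A t - heisenberg K A t =
      -(NormedSpace.exp (-t • G) * f t * NormedSpace.exp (t • G)) := by
    have e1 := exp_neg_smul_mul_exp_smul G t
    have e2 : NormedSpace.exp (-t • G) * f t * NormedSpace.exp (t • G) =
        (NormedSpace.exp (-t • G) * NormedSpace.exp (t • G)) * heisenberg K A t *
          (NormedSpace.exp (-t • G) * NormedSpace.exp (t • G)) - heisenberg G A t := by
      simp only [hf, heisenberg]
      noncomm_ring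
    rw [e2, e1]
    simp
  calc ‖heisenberg G A t - heisenberg K A t‖
      ≤ ‖NormedSpace.exp (-t • G)‖ * ‖f t‖ * ‖NormedSpace.exp (t • G)‖ := by
        rw [hrew, norm_neg]
        exact norm_mul₃_le
    _ ≤ 1 * ‖f t‖ * 1 := by
        gcongr
        · exact hG (-t)
        · exact hG t
    _ ≤ _ := by simpa using hft

end Abstract

/-! ### Windows of the chain in a ring -/

section Window

/-- The sites `j - r, …, j + r`. -/
abbrev window (j : ℤ) (r : ℕ) : Finset ℤ := Finset.Icc (j - r) (j + r)

/-- The position in the ring `ZMod L` of the sites of a window. -/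
def windowMap (j : ℤ) (r L : ℕ) : window j r → ZMod L := fun x => ((x : ℤ) : ZMod L)

theorem intCast_ne_of_lt {L : ℕ} {x y : ℤ} (h1 : y < x) (h2 : x < y + L) :
    (x : ZMod L) ≠ (y : ZMod L) := by
  intro h
  rw [eq_comm, ZMod.intCast_eq_intCast_iff_dvd_sub] at h
  have := Int.le_of_dvd (by omega) h
  omega

theorem intCast_injOn_Ico (L : ℕ) (c : ℤ) :
    Set.InjOn (fun x : ℤ => (x : ZMod L)) (Set.Ico c (c + L)) := by
  intro x hx y hy h
  by_contra hne
  rcases lt_or_gt_of_ne hne with h1 | h1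
  · exact intCast_ne_of_lt h1 (by have := hx.1; have := hy.2; omega) h.symm
  · exact intCast_ne_of_lt h1 (by have := hx.2; have := hy.1; omega) h

theorem exists_int_rep {L : ℕ} [NeZero L] (c : ℤ) (a : ZMod L) :
    ∃ x : ℤ, c ≤ x ∧ x < c + L ∧ (x : ZMod L) = a := by
  refine ⟨c + ((a - (c : ZMod L)).val : ℤ), by omega, ?_, ?_⟩
  · have := ZMod.val_lt (a - (c : ZMod L))
    omega
  · push_cast
    rw [ZMod.natCast_zmod_val]
    ring

theorem windowMap_injective {j : ℤ} {r L : ℕ} (h : 2 * r + 1 ≤ L) :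
    Function.Injective (windowMap j r L) := by
  rintro ⟨x, hx⟩ ⟨y, hy⟩ hxy
  rw [Finset.mem_Icc] at hx hy
  have : x = y := intCast_injOn_Ico L (j - r) ⟨hx.1, by omega⟩ ⟨hy.1, by omega⟩ hxy
  exact Subtype.ext this

theorem self_mem_window (j : ℤ) (r : ℕ) : j ∈ window j r := by
  rw [Finset.mem_Icc]
  omega

theorem single_eq_embed_windowMap (j : ℤ) {r L : ℕ} (h : 2 * r + 1 ≤ L) (O : Op Unit) :
    single (j : ZMod L) O =
      embed (windowMap j r L) (embed (fun _ : Unit => ⟨j, self_mem_window j r⟩) O) := by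
  rw [embed_embed (windowMap_injective h)]
  rfl

/-- The open-boundary Hamiltonian of a window. -/
def windowHam (Φ : Interaction) (j : ℤ) (r : ℕ) : Op (window j r) :=
  ∑ X ∈ ((window j r).powerset.filter Finset.Nonempty).attach,
    embed (fun x : X.1 =>
      ⟨x.1, Finset.mem_powerset.1 (Finset.mem_filter.1 X.2).1 x.2⟩) (Φ.h X.1)

theorem hamRestricted_eq_sum (Φ : Interaction) (L : ℕ) {L' : ℝ} (hL' : 0 ≤ L') (j : ℤ) :
    Φ.hamRestricted L L' j =
      ∑ X ∈ (window j ⌊L' / 2⌋₊).powerset with X.Nonempty,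
        embed (fun x : X => ((x : ℤ) : ZMod L)) (Φ.h X) := by
  have h1 : ⌈(j : ℝ) - L' / 2⌉ = j - (⌊L' / 2⌋₊ : ℤ) := by
    rw [sub_eq_add_neg, add_comm, Int.ceil_add_intCast, Int.ceil_neg,
      Int.natCast_floor_eq_floor (by positivity)]
    ring
  have h2 : ⌊(j : ℝ) + L' / 2⌋ = j + (⌊L' / 2⌋₊ : ℤ) := by
    rw [add_comm, Int.floor_add_intCast, Int.natCast_floor_eq_floor (by positivity)]
    ring
  rw [Interaction.hamRestricted, h1, h2]

theorem hamRestricted_eq_embed (Φ : Interaction) {L : ℕ} [NeZero L] {L' : ℝ} (hL' : 0 ≤ L') (j : ℤ)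
    (h : 2 * ⌊L' / 2⌋₊ + 1 ≤ L) :
    Φ.hamRestricted L L' j =
      embed (windowMap j ⌊L' / 2⌋₊ L) (windowHam Φ j ⌊L' / 2⌋₊) := by
  rw [hamRestricted_eq_sum Φ L hL', windowHam, embed_sum, ← Finset.sum_attach]
  refine Finset.sum_congr rfl fun X _ => ?_
  rw [embed_embed (windowMap_injective h)]
  rfl

theorem isHermitian_embed {κ ι : Type*} (f : κ → ι) {A : Op κ} (hA : A.IsHermitian) :
    (embed f A).IsHermitian := by
  rw [Matrix.IsHermitian, ← embed_conjTranspose, hA.eq]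

theorem isHermitian_sum {n α : Type*} (S : Finset α) {A : α → Matrix n n ℂ}
    (hA : ∀ x ∈ S, (A x).IsHermitian) : (∑ x ∈ S, A x).IsHermitian := by
  rw [Matrix.IsHermitian, Matrix.conjTranspose_sum]
  exact Finset.sum_congr rfl hA

theorem hamPBC_isHermitian (Φ : Interaction) (dH L : ℕ) : (Φ.hamPBC dH L).IsHermitian :=
  isHermitian_sum _ fun X _ => isHermitian_embed _ (Φ.hermitian X)

theorem hamRestricted_isHermitian (Φ : Interaction) (L : ℕ) (L' : ℝ) (j : ℤ) :
    (Φ.hamRestricted L L' j).IsHermitian :=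
  isHermitian_sum _ fun X _ => isHermitian_embed _ (Φ.hermitian X)

end Window

/-! ### The interaction terms of a ring -/

section Terms

/-- The possible supports of a term of range `dH`, up to translations: the leftmost site is `0`. -/
def shapes (dH : ℕ) : Finset (Finset ℤ) := (Finset.Icc (0 : ℤ) dH).powerset.filter (0 ∈ ·)

theorem mem_shapes {dH : ℕ} {S : Finset ℤ} :
    S ∈ shapes dH ↔ (∀ x ∈ S, 0 ≤ x ∧ x ≤ dH) ∧ 0 ∈ S := by
  simp [shapes, Finset.subset_iff]

/-- The term on the ring whose support is the shape `p.2` with the leftmost site put at `p.1`. -/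
def ringTerm (Φ : Interaction) (L : ℕ) (p : ZMod L × Finset ℤ) : Op (ZMod L) :=
  embed (fun x : p.2 => ((x : ℤ) : ZMod L) + p.1) (Φ.h p.2)

theorem ringTerm_eq_embed_map (Φ : Interaction) (L : ℕ) (a : ℤ) (S : Finset ℤ) :
    ringTerm Φ L ((a : ZMod L), S) =
      embed (fun x : (S.map (addRightEmbedding a) : Finset ℤ) => ((x : ℤ) : ZMod L))
        (Φ.h (S.map (addRightEmbedding a))) := by
  let e : S ≃ (S.map (addRightEmbedding a) : Finset ℤ) :=
    { toFun := fun x => ⟨x.1 + a, Finset.mem_map_of_mem _ x.2⟩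
      invFun := fun y => ⟨y.1 - a, by
        obtain ⟨x, hx, hxy⟩ := Finset.mem_map.1 y.2
        rw [← hxy]
        simpa using hx⟩
      left_inv := fun x => by simp
      right_inv := fun y => by simp }
  have := embed_equiv e (fun x : (S.map (addRightEmbedding a) : Finset ℤ) => ((x : ℤ) : ZMod L))
    (Φ.h (S.map (addRightEmbedding a))) (Φ.h S) (fun s t => Φ.translate S a s t)
  rw [this, ringTerm]
  congr 1
  funext x
  simp [e]

theorem ringTerm_isHermitian (Φ : Interaction) (L : ℕ) (p : ZMod L × Finset ℤ) :
    (ringTerm Φ L p).IsHermitian :=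
  isHermitian_embed _ (Φ.hermitian _)

theorem norm_ringTerm_le (Φ : Interaction) {L dH : ℕ} [NeZero L] (hL : dH < L)
    {p : ZMod L × Finset ℤ} (hp : p.2 ∈ shapes dH) : ‖ringTerm Φ L p‖ ≤ ‖Φ.h p.2‖ := by
  refine norm_embed_le ?_ _
  rintro ⟨x, hx⟩ ⟨y, hy⟩ hxy
  rw [mem_shapes] at hp
  have := hp.1 x hx
  have := hp.1 y hy
  have : x = y := intCast_injOn_Ico L 0 ⟨by omega, by omega⟩ ⟨by omega, by omega⟩
    (add_right_cancel hxy)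
  exact Subtype.ext this

theorem map_addRight_injOn (dH : ℕ) : Set.InjOn
    (fun p : ℤ × Finset ℤ => p.2.map (addRightEmbedding p.1)) {p | p.2 ∈ shapes dH} := by
  rintro ⟨a, S⟩ hS ⟨b, T⟩ hT h
  simp only [Set.mem_ofPred_eq, mem_shapes] at hS hT h
  have hab : a = b := by
    have h1 : a ∈ T.map (addRightEmbedding b) := by
      rw [← h]
      simpa using hS.2
    have h2 : b ∈ S.map (addRightEmbedding a) := by
      rw [h]
      simpa using hT.2
    rw [Finset.mem_map] at h1 h2
    obtain ⟨x, hx, hxa⟩ := h1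
    obtain ⟨y, hy, hyb⟩ := h2
    have := (hT.1 x hx).1
    have := (hS.1 y hy).1
    simp only [addRightEmbedding_apply] at hxa hyb
    omega
  subst hab
  exact Prod.ext rfl (Finset.map_injective _ h)

/-- A nonempty set of sites is a translated shape, unless its term vanishes. -/
theorem exists_shape {Φ : Interaction} {g : ℝ} {k dH : ℕ} (hΦ : Φ.IsLocal g k dH) {X : Finset ℤ}
    {a : ℤ} (ha : a ∈ X) (hmin : ∀ x ∈ X, a ≤ x) (hne : Φ.h X ≠ 0) :
    ∃ S ∈ shapes dH, X = S.map (addRightEmbedding a) := by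
  refine ⟨X.map (addRightEmbedding (-a)), ?_, ?_⟩
  · rw [mem_shapes]
    refine ⟨fun x hx => ?_, ?_⟩
    · rw [Finset.mem_map] at hx
      obtain ⟨y, hy, rfl⟩ := hx
      simp only [addRightEmbedding_apply]
      have := hmin y hy
      have h2 : ¬ (dH : ℤ) < |y - a| := fun h => hne (hΦ.range X ⟨y, hy, a, ha, h⟩)
      rw [abs_of_nonneg (by omega)] at h2
      omega
    · rw [Finset.mem_map]
      exact ⟨a, ha, by simp⟩
  · ext x
    simp

variable {Φ : Interaction} {g : ℝ} {k dH : ℕ}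

theorem hamPBC_eq_sum_ringTerm (hΦ : Φ.IsLocal g k dH) (L : ℕ) [NeZero L] :
    Φ.hamPBC dH L = ∑ p ∈ Finset.univ ×ˢ shapes dH, ringTerm Φ L p := by
  classical
  have h1 : ∑ p ∈ Finset.Ico (0 : ℤ) L ×ˢ shapes dH, ringTerm Φ L ((p.1 : ZMod L), p.2) =
      Φ.hamPBC dH L := by
    rw [Interaction.hamPBC]
    refine Finset.sum_of_injOn (fun p => p.2.map (addRightEmbedding p.1)) ?_ ?_ ?_ ?_
    · exact (map_addRight_injOn dH).mono fun p hp => (Finset.mem_product.1 hp).2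
    · rintro ⟨a, S⟩ hp
      simp only [Finset.coe_product, Set.mem_prod, Finset.mem_coe, Finset.mem_Ico, mem_shapes] at hp
      simp only [Finset.coe_filter, Set.mem_ofPred_eq, Finset.mem_powerset, Finset.subset_iff,
        Finset.mem_map, addRightEmbedding_apply, Finset.mem_Ico]
      refine ⟨?_, a, ⟨0, hp.2.2, by simp⟩, hp.1.2, ?_⟩
      · rintro _ ⟨x, hx, rfl⟩
        have := hp.2.1 x hx
        omega
      · rintro _ ⟨x, hx, rfl⟩
        have := hp.2.1 x hx
        omega
    · intro X hX hX'
      by_cases hne : Φ.h X = 0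
      · rw [hne, embed_zero]
      rw [Finset.mem_filter, Finset.mem_powerset] at hX
      obtain ⟨hsub, a, ha, haL, hmin⟩ := hX
      obtain ⟨S, hS, rfl⟩ := exists_shape hΦ ha hmin hne
      refine absurd ⟨(a, S), ?_, rfl⟩ hX'
      have := Finset.mem_Ico.1 (hsub ha)
      simp only [Finset.coe_product, Set.mem_prod, Finset.mem_coe, Finset.mem_Ico]
      exact ⟨⟨this.1, haL⟩, hS⟩
    · rintro ⟨a, S⟩ -
      exact ringTerm_eq_embed_map Φ L a S
  rw [← h1]
  refine Finset.sum_of_injOn (fun p => ((p.1 : ZMod L), p.2)) ?_ ?_ ?_ (fun _ _ => rfl)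
  · rintro ⟨a, S⟩ hp ⟨b, T⟩ hq h
    simp only [Finset.coe_product, Set.mem_prod, Finset.mem_coe, Finset.mem_Ico] at hp hq
    simp only [Prod.mk.injEq] at h
    exact Prod.ext (intCast_injOn_Ico L 0 ⟨hp.1.1, by omega⟩ ⟨hq.1.1, by omega⟩ h.1) h.2
  · rintro ⟨a, S⟩ hp
    simp only [Finset.coe_product, Set.mem_prod, Finset.mem_coe] at hp ⊢
    exact ⟨Finset.mem_univ _, hp.2⟩
  · rintro ⟨a, S⟩ hp hp'
    obtain ⟨x, hx, hx', rfl⟩ := exists_int_rep 0 a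
    refine absurd ⟨(x, S), ?_, rfl⟩ hp'
    simp only [Finset.coe_product, Set.mem_prod, Finset.mem_coe, Finset.mem_Ico]
    exact ⟨⟨hx, by omega⟩, (Finset.mem_product.1 hp).2⟩

/-- The terms of the ring whose support lies in a window and does not cross its ends. -/
def windowTerms (dH L : ℕ) (j : ℤ) (r : ℕ) : Finset (ZMod L × Finset ℤ) :=
  ((window j r ×ˢ shapes dH).filter fun p => ∀ x ∈ p.2, x + p.1 ≤ j + r).image
    fun p => ((p.1 : ZMod L), p.2)

theorem mem_windowTerms {L r : ℕ} {j : ℤ} {p : ZMod L × Finset ℤ} :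
    p ∈ windowTerms dH L j r ↔
      ∃ a : ℤ, (j - r ≤ a ∧ a ≤ j + r) ∧ p.2 ∈ shapes dH ∧ (∀ x ∈ p.2, x + a ≤ j + r) ∧
        (a : ZMod L) = p.1 := by
  simp only [windowTerms, Finset.mem_image, Finset.mem_filter, Finset.mem_product, Finset.mem_Icc]
  constructor
  · rintro ⟨⟨a, S⟩, ⟨⟨h1, h2⟩, h3⟩, rfl⟩
    exact ⟨a, h1, h2, h3, rfl⟩
  · rintro ⟨a, h1, h2, h3, h4⟩
    exact ⟨(a, p.2), ⟨⟨h1, h2⟩, h3⟩, Prod.ext h4 rfl⟩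

theorem windowTerms_subset {L r r' : ℕ} (h : r' ≤ r) (j : ℤ) :
    windowTerms dH L j r' ⊆ windowTerms dH L j r := by
  intro p hp
  rw [mem_windowTerms] at hp ⊢
  obtain ⟨a, h1, h2, h3, h4⟩ := hp
  exact ⟨a, by omega, h2, fun x hx => (h3 x hx).trans (by omega), h4⟩

theorem windowTerms_subset_univ {L r : ℕ} [NeZero L] (j : ℤ) :
    windowTerms dH L j r ⊆ Finset.univ ×ˢ shapes dH := by
  intro p hp
  rw [mem_windowTerms] at hp
  obtain ⟨a, h1, h2, h3, h4⟩ := hp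
  exact Finset.mem_product.2 ⟨Finset.mem_univ _, h2⟩

theorem embed_windowHam_eq_sum_ringTerm (hΦ : Φ.IsLocal g k dH) {L r : ℕ} [NeZero L]
    (h : 2 * r + 1 ≤ L) (j : ℤ) :
    embed (windowMap j r L) (windowHam Φ j r) = ∑ p ∈ windowTerms dH L j r, ringTerm Φ L p := by
  classical
  have h0 : embed (windowMap j r L) (windowHam Φ j r) =
      ∑ X ∈ (window j r).powerset with X.Nonempty,
        embed (fun x : X => ((x : ℤ) : ZMod L)) (Φ.h X) := by
    rw [windowHam, embed_sum, ← Finset.sum_attach (((window j r).powerset.filter Finset.Nonempty))]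
    refine Finset.sum_congr rfl fun X _ => ?_
    rw [embed_embed (windowMap_injective h)]
    rfl
  rw [h0, windowTerms, Finset.sum_image]
  · symm
    refine Finset.sum_of_injOn (fun p => p.2.map (addRightEmbedding p.1)) ?_ ?_ ?_ ?_
    · exact (map_addRight_injOn dH).mono fun p hp =>
        (Finset.mem_product.1 (Finset.mem_filter.1 hp).1).2
    · rintro ⟨a, S⟩ hp
      simp only [Finset.mem_coe, Finset.mem_filter, Finset.mem_product, Finset.mem_Icc,
        mem_shapes] at hp
      simp only [Finset.coe_filter, Set.mem_ofPred_eq, Finset.mem_powerset, Finset.subset_iff,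
        Finset.mem_map, addRightEmbedding_apply, Finset.mem_Icc]
      refine ⟨?_, ⟨a, Finset.mem_map.2 ⟨0, hp.1.2.2, by simp⟩⟩⟩
      rintro _ ⟨x, hx, rfl⟩
      have := hp.1.2.1 x hx
      have := hp.2 x hx
      omega
    · intro X hX hX'
      by_cases hne : Φ.h X = 0
      · rw [hne, embed_zero]
      rw [Finset.mem_filter, Finset.mem_powerset] at hX
      obtain ⟨hsub, hX0⟩ := hX
      obtain ⟨S, hS, hXS⟩ := exists_shape hΦ (X.min'_mem hX0) (fun x hx => X.min'_le x hx) hne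
      refine absurd ⟨(X.min' hX0, S), ?_, hXS.symm⟩ hX'
      have := Finset.mem_Icc.1 (hsub (X.min'_mem hX0))
      simp only [Finset.mem_coe, Finset.mem_filter, Finset.mem_product, Finset.mem_Icc]
      refine ⟨⟨this, hS⟩, fun x hx => ?_⟩
      have : x + X.min' hX0 ∈ X := (Finset.ext_iff.1 hXS _).2 (Finset.mem_map.2 ⟨x, hx, rfl⟩)
      exact (Finset.mem_Icc.1 (hsub this)).2
    · rintro ⟨a, S⟩ -
      exact ringTerm_eq_embed_map Φ L a S
  · rintro ⟨a, S⟩ hp ⟨b, T⟩ hq hab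
    simp only [Finset.mem_coe, Finset.mem_filter, Finset.mem_product, Finset.mem_Icc] at hp hq
    simp only [Prod.mk.injEq] at hab
    exact Prod.ext (intCast_injOn_Ico L (j - r) ⟨hp.1.1.1, by omega⟩ ⟨hq.1.1.1, by omega⟩ hab.1)
      hab.2

/-- The leftmost sites of those terms that may cross an end of a window. -/
def windowBoundary (dH L : ℕ) (j : ℤ) (r : ℕ) : Finset (ZMod L) :=
  (Finset.Ico (j + r + 1 - dH) (j + r + 1) ∪ Finset.Ico (j - r - dH) (j - r)).image
    fun x : ℤ => (x : ZMod L)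

theorem card_windowBoundary_le (dH L : ℕ) (j : ℤ) (r : ℕ) :
    (windowBoundary dH L j r).card ≤ 2 * dH := by
  refine Finset.card_image_le.trans ((Finset.card_union_le _ _).trans ?_)
  simp only [Int.card_Ico]
  omega

/-- The terms that do not belong to a window keep a distance from all smaller windows. -/
theorem ringTerm_support_ne {L r r' : ℕ} [NeZero L] {j : ℤ} (hr : r' + dH ≤ r)
    {p : ZMod L × Finset ℤ} (hp : p.2 ∈ shapes dH) (hp' : p ∉ windowTerms dH L j r)
    (x : p.2) (y : window j r') : ((x : ℤ) : ZMod L) + p.1 ≠ windowMap j r' L y := by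
  obtain ⟨a, ha1, ha2, ha⟩ := exists_int_rep (j - r) p.1
  have hgt : j + r - dH < a := by
    by_contra hle
    refine hp' (mem_windowTerms.2 ⟨a, by omega, hp, fun x hx => ?_, ha⟩)
    have := ((mem_shapes.1 hp).1 x hx).2
    omega
  have hx := (mem_shapes.1 hp).1 x.1 x.2
  have hy := Finset.mem_Icc.1 y.2
  rw [windowMap, ← ha, ← Int.cast_add]
  exact intCast_ne_of_lt (by omega) (by omega)

/-- The terms that neither belong to a window nor cross its ends are disjoint from it. -/
theorem ringTerm_support_ne_of_not_mem_boundary {L r : ℕ} [NeZero L] {j : ℤ}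
    {p : ZMod L × Finset ℤ} (hp : p.2 ∈ shapes dH) (hp' : p ∉ windowTerms dH L j r)
    (hb : p.1 ∉ windowBoundary dH L j r) (x : p.2) (y : window j r) :
    ((x : ℤ) : ZMod L) + p.1 ≠ windowMap j r L y := by
  obtain ⟨a, ha1, ha2, ha⟩ := exists_int_rep (j - r) p.1
  have hgt : j + r - dH < a := by
    by_contra hle
    refine hp' (mem_windowTerms.2 ⟨a, by omega, hp, fun x hx => ?_, ha⟩)
    have := ((mem_shapes.1 hp).1 x hx).2
    omega
  have hgt' : j + r < a := by
    by_contra hle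
    refine hb (Finset.mem_image.2 ⟨a, ?_, ha⟩)
    simp only [Finset.mem_union, Finset.mem_Ico]
    omega
  have hlt : a < j - r + L - dH := by
    by_contra hle
    refine hb (Finset.mem_image.2 ⟨a - L, ?_, ?_⟩)
    · simp only [Finset.mem_union, Finset.mem_Ico]
      omega
    · rw [← ha]
      simp
  have hx := (mem_shapes.1 hp).1 x.1 x.2
  have hy := Finset.mem_Icc.1 y.2
  rw [windowMap, ← ha, ← Int.cast_add]
  exact intCast_ne_of_lt (by omega) (by omega)

theorem sum_norm_shapes_le (hΦ : Φ.IsLocal g k dH) : ∑ S ∈ shapes dH, ‖Φ.h S‖ ≤ g :=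
  hΦ.extensive 0 (shapes dH) fun _ hS => (mem_shapes.1 hS).2

theorem norm_sum_ringTerm_boundary_le (hΦ : Φ.IsLocal g k dH) {L r : ℕ} [NeZero L] (hL : dH < L)
    (j : ℤ) {T : Finset (ZMod L × Finset ℤ)} (hT : T ⊆ windowBoundary dH L j r ×ˢ shapes dH) :
    ‖∑ p ∈ T, ringTerm Φ L p‖ ≤ 2 * dH * g := by
  have hg : 0 ≤ g := (Finset.sum_nonneg fun _ _ => norm_nonneg _).trans (sum_norm_shapes_le hΦ)
  calc ‖∑ p ∈ T, ringTerm Φ L p‖ ≤ ∑ p ∈ T, ‖ringTerm Φ L p‖ := norm_sum_le _ _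
    _ ≤ ∑ p ∈ T, ‖Φ.h p.2‖ := Finset.sum_le_sum fun p hp =>
        norm_ringTerm_le Φ hL (Finset.mem_product.1 (hT hp)).2
    _ ≤ ∑ p ∈ windowBoundary dH L j r ×ˢ shapes dH, ‖Φ.h p.2‖ :=
        Finset.sum_le_sum_of_subset_of_nonneg hT fun _ _ _ => norm_nonneg _
    _ = (windowBoundary dH L j r).card * ∑ S ∈ shapes dH, ‖Φ.h S‖ := by
        rw [Finset.sum_product]
        exact (Finset.sum_const (∑ S ∈ shapes dH, ‖Φ.h S‖)).trans (nsmul_eq_mul _ _)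
    _ ≤ ((2 * dH : ℕ) : ℝ) * g := by
        gcongr
        · exact card_windowBoundary_le dH L j r
        · exact sum_norm_shapes_le hΦ
    _ = 2 * dH * g := by push_cast; ring

end Terms

/-! ### Quasi-locality of the evolution -/

section QuasiLocality

variable {Φ : Interaction} {g : ℝ} {k dH : ℕ}

theorem conj_evolution_eq_heisenberg {n : Type*} [Fintype n] [DecidableEq n] {H : Matrix n n ℂ}
    (hH : H.IsHermitian) (A : Matrix n n ℂ) (t : ℝ) :
    (evolution H t).conjTranspose * A * evolution H t = heisenberg (-(Complex.I • H)) A t := by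
  rw [evolution_conjTranspose hH, evolution_eq_exp_smul, evolution_eq_exp_smul, heisenberg]

/-- The terms of a window determine the evolution of an observable at its centre up to an error
which decreases factorially with the radius of the window. -/
theorem norm_heisenberg_sub_window_le (hΦ : Φ.IsLocal g k dH) {L : ℕ} [NeZero L] (hL : dH < L)
    (j : ℤ) {O : Op Unit} (hO : ‖O‖ ≤ 1) (n : ℕ) :
    ∀ r : ℕ, n * (dH + 1) ≤ r → 2 * r + 1 ≤ L → ∀ T : Finset (ZMod L × Finset ℤ),
      windowTerms dH L j r ⊆ T → T ⊆ Finset.univ ×ˢ shapes dH → ∀ t : ℝ, 0 ≤ t →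
        ‖heisenberg (-(Complex.I • ∑ p ∈ T, ringTerm Φ L p)) (single (j : ZMod L) O) t -
          heisenberg (-(Complex.I • ∑ p ∈ windowTerms dH L j r, ringTerm Φ L p))
            (single (j : ZMod L) O) t‖ ≤
          2 * (2 * (2 * dH * g)) ^ n * (t ^ n / n !) := by
  classical
  have hherm : ∀ T : Finset (ZMod L × Finset ℤ), (∑ p ∈ T, ringTerm Φ L p).IsHermitian :=
    fun T => isHermitian_sum _ fun p _ => ringTerm_isHermitian Φ L p
  have hA : ‖single (j : ZMod L) O‖ ≤ 1 := (norm_single_le _ _).trans hO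
  -- each step shrinks the window by `dH + 1`, and compares with the previous bound for its terms
  induction n with
  | zero =>
    intro r _ _ T _ _ t _
    rw [← conj_evolution_eq_heisenberg (hherm _), ← conj_evolution_eq_heisenberg (hherm _)]
    refine (norm_sub_le _ _).trans ?_
    have h1 := (norm_conj_le (evolution_mem_unitary (hherm T) t) (single (j : ZMod L) O)).trans hA
    have h2 := (norm_conj_le (evolution_mem_unitary (hherm (windowTerms dH L j r)) t)
      (single (j : ZMod L) O)).trans hA
    simp only [pow_zero, Nat.factorial_zero]
    norm_num
    linarith
  | succ n ih =>
    intro r hr hrL T hrT hT t ht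
    obtain ⟨r', rfl⟩ : ∃ r', r = r' + (dH + 1) :=
      ⟨r - (dH + 1), by rw [Nat.sub_add_cancel]; nlinarith⟩
    set r := r' + (dH + 1) with hrdef
    set N := T \ windowTerms dH L j r with hN
    have hNmem : ∀ p ∈ N, p.2 ∈ shapes dH ∧ p ∉ windowTerms dH L j r := fun p hp =>
      ⟨(Finset.mem_product.1 (hT (Finset.mem_sdiff.1 hp).1)).2, (Finset.mem_sdiff.1 hp).2⟩
    -- the terms that may cross the ends of the window, and the remote ones
    set E := ∑ p ∈ N.filter (·.1 ∈ windowBoundary dH L j r), ringTerm Φ L p with hEdef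
    set F := ∑ p ∈ N.filter (·.1 ∉ windowBoundary dH L j r), ringTerm Φ L p with hFdef
    have hdec : ∑ p ∈ T, ringTerm Φ L p =
        ∑ p ∈ windowTerms dH L j r, ringTerm Φ L p + E + F := by
      rw [add_assoc, hEdef, hFdef, Finset.sum_filter_add_sum_filter_not, hN,
        add_comm, Finset.sum_sdiff hrT]
    have hF : ∀ W : Op (window j r), Commute F (embed (windowMap j r L) W) := fun W =>
      Commute.sum_left _ _ _ fun p hp => commute_embed (fun x y =>
        ringTerm_support_ne_of_not_mem_boundary (hNmem p (Finset.mem_filter.1 hp).1).1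
          (hNmem p (Finset.mem_filter.1 hp).1).2 (Finset.mem_filter.1 hp).2 x y) _ _
    have hE : ∀ W : Op (window j r'), Commute E (embed (windowMap j r' L) W) := fun W =>
      Commute.sum_left _ _ _ fun p hp => commute_embed (fun x y =>
        ringTerm_support_ne (by omega) (hNmem p (Finset.mem_filter.1 hp).1).1
          (hNmem p (Finset.mem_filter.1 hp).1).2 x y) _ _
    have hscal : ∀ {A B : Op (ZMod L)}, Commute A B →
        Commute (-(Complex.I • A)) (-(Complex.I • B)) := fun h =>
      ((h.smul_left _).smul_right _).neg_left.neg_right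
    have hscal' : ∀ {A B : Op (ZMod L)}, Commute A B → Commute (-(Complex.I • A)) B := fun h =>
      (h.smul_left _).neg_left
    have key := norm_heisenberg_sub_le_of_step
      (G := -(Complex.I • ∑ p ∈ T, ringTerm Φ L p))
      (K := -(Complex.I • ∑ p ∈ windowTerms dH L j r, ringTerm Φ L p))
      (K' := -(Complex.I • ∑ p ∈ windowTerms dH L j r', ringTerm Φ L p))
      (E := -(Complex.I • E)) (F := -(Complex.I • F)) (A := single (j : ZMod L) O)
      (b := 2 * dH * g) (c := 2 * (2 * (2 * dH * g)) ^ n) (n := n) ?_ ?_ ?_ ?_ ?_ ?_ ?_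
      (ih r' (by rw [hrdef] at hr; nlinarith) (by omega) _ (windowTerms_subset (by omega) j)
        (windowTerms_subset_univ j)) t ht
    · refine key.trans_eq ?_
      rw [pow_succ]
      ring
    · intro s
      rw [← evolution_eq_exp_smul]
      exact norm_le_one_of_mem_unitary (evolution_mem_unitary (hherm T) s)
    · rw [hdec, smul_add, smul_add, neg_add, neg_add]
    · rw [← embed_windowHam_eq_sum_ringTerm hΦ hrL]
      exact hscal (hF _)
    · rw [single_eq_embed_windowMap j hrL]
      exact hscal' (hF _)
    · rw [← embed_windowHam_eq_sum_ringTerm hΦ (by omega : 2 * r' + 1 ≤ L)]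
      exact hscal (hE _)
    · rw [single_eq_embed_windowMap j (by omega : 2 * r' + 1 ≤ L)]
      exact hscal' (hE _)
    · rw [norm_neg, norm_smul, Complex.norm_I, one_mul]
      refine norm_sum_ringTerm_boundary_le (r := r) hΦ hL j fun p hp => ?_
      rw [Finset.mem_filter] at hp
      exact Finset.mem_product.2 ⟨hp.2, (hNmem p hp.1).1⟩

theorem norm_target_sub_window_le (hΦ : Φ.IsLocal g k dH) {L r n : ℕ} [NeZero L] (hL : dH < L)
    (hn : n * (dH + 1) ≤ r) (hr : 2 * r + 1 ≤ L) (j : ℤ) {O : Op Unit} (hO : ‖O‖ ≤ 1) {τ : ℝ}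
    (hτ : 0 ≤ τ) :
    ‖(Φ.target dH τ L).conjTranspose * single (j : ZMod L) O * Φ.target dH τ L -
      (evolution (embed (windowMap j r L) (windowHam Φ j r)) τ).conjTranspose *
        single (j : ZMod L) O * evolution (embed (windowMap j r L) (windowHam Φ j r)) τ‖ ≤
      2 * (2 * (2 * dH * g)) ^ n * (τ ^ n / n !) := by
  have h2 : (embed (windowMap j r L) (windowHam Φ j r)).IsHermitian := by
    rw [embed_windowHam_eq_sum_ringTerm hΦ hr]
    exact isHermitian_sum _ fun p _ => ringTerm_isHermitian Φ L p
  rw [Interaction.target, conj_evolution_eq_heisenberg (hamPBC_isHermitian Φ dH L),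
    conj_evolution_eq_heisenberg h2, hamPBC_eq_sum_ringTerm hΦ,
    embed_windowHam_eq_sum_ringTerm hΦ hr]
  exact norm_heisenberg_sub_window_le hΦ hL j hO n r hn hr _ (windowTerms_subset_univ j)
    subset_rfl τ hτ

end QuasiLocality

/-! ### Exponential bounds -/

section Bounds

/-- Factorial decay is faster than any exponential decay. -/
theorem pow_div_factorial_le_exp_mul {K ξ : ℝ} (hK : 0 ≤ K) (hξ : 0 < ξ) {w : ℕ} (hw : 0 < w)
    (r : ℕ) :
    K ^ (r / w) / (r / w)! ≤
      Real.exp (w / ξ) * Real.exp (K * Real.exp (w / ξ)) * Real.exp (-(r / ξ)) := by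
  set n := r / w with hn
  have hr : (r : ℝ) ≤ w * n + w := by
    have h := Nat.lt_mul_div_succ r hw
    rw [← hn] at h
    have : r ≤ w * n + w := by linarith [h]
    exact_mod_cast this
  have h1 := Real.pow_div_factorial_le_exp (x := K * Real.exp (w / ξ)) (by positivity) n
  have h2 : Real.exp (r / ξ) ≤ Real.exp (w / ξ) * Real.exp (w / ξ) ^ n := by
    rw [← Real.exp_nat_mul, ← Real.exp_add, Real.exp_le_exp]
    calc r / ξ ≤ (w * n + w) / ξ := by gcongr
      _ = w / ξ + n * (w / ξ) := by ring
  rw [Real.exp_neg, ← div_eq_mul_inv, le_div_iff₀ (Real.exp_pos _)]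
  calc K ^ n / n ! * Real.exp (r / ξ)
      ≤ K ^ n / n ! * (Real.exp (w / ξ) * Real.exp (w / ξ) ^ n) := by gcongr
    _ = Real.exp (w / ξ) * ((K * Real.exp (w / ξ)) ^ n / n !) := by
        rw [mul_pow]
        ring
    _ ≤ Real.exp (w / ξ) * Real.exp (K * Real.exp (w / ξ)) := by gcongr

theorem epsLR_eq (dH : ℕ) {v ξ τ l₀ C' : ℝ} (hξ : 0 < ξ) :
    epsLR dH v ξ τ l₀ C' = C' * (ξ * Real.exp (-(l₀ / ξ))) := by
  have h : ∀ x : ℝ, Real.exp (-(x - v * τ) / ξ) =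
      Real.exp (v * τ / ξ) * Real.exp (-(1 / ξ) * x) := by
    intro x
    rw [← Real.exp_add]
    congr 1
    field_simp
    ring
  rw [epsLR]
  congr 1
  simp_rw [h]
  rw [MeasureTheory.integral_const_mul, integral_exp_mul_Ioi (by simpa using hξ), neg_div_neg_eq,
    ← mul_div_assoc, ← Real.exp_add, div_div_eq_mul_div, div_one, mul_comm ξ, restrictionSize]
  congr 2
  field_simp
  ring

variable {Φ : Interaction} {g : ℝ} {k dH : ℕ}

theorem IsNormalizedObservable.norm_le {O : Op Unit} (hO : IsNormalizedObservable O) : ‖O‖ ≤ 1 :=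
  hO.2.le

theorem Interaction.IsLocal.nonneg (hΦ : Φ.IsLocal g k dH) : 0 ≤ g := by
  simpa using hΦ.extensive 0 ∅ (by simp)

/-- The quasi-locality of the evolution, with exponential decay at an arbitrary rate. -/
theorem norm_target_sub_window_le_exp (hΦ : Φ.IsLocal g k dH) {L r : ℕ} [NeZero L] (hL : dH < L)
    (hr : 2 * r + 1 ≤ L) (j : ℤ) {O : Op Unit} (hO : ‖O‖ ≤ 1) {τ ξ : ℝ} (hτ : 0 ≤ τ) (hξ : 0 < ξ) :
    ‖(Φ.target dH τ L).conjTranspose * single (j : ZMod L) O * Φ.target dH τ L -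
      (evolution (embed (windowMap j r L) (windowHam Φ j r)) τ).conjTranspose *
        single (j : ZMod L) O * evolution (embed (windowMap j r L) (windowHam Φ j r)) τ‖ ≤
      2 * (Real.exp ((dH + 1 : ℕ) / ξ) *
        Real.exp (2 * (2 * dH * |g|) * τ * Real.exp ((dH + 1 : ℕ) / ξ)) * Real.exp (-(r / ξ))) := by
  have h1 := norm_target_sub_window_le hΦ hL (Nat.div_mul_le_self r (dH + 1)) hr j hO hτ
  have h2 := pow_div_factorial_le_exp_mul (K := 2 * (2 * dH * |g|) * τ) (by positivity) hξ
    (Nat.succ_pos dH) r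
  rw [abs_of_nonneg hΦ.nonneg] at h2 ⊢
  refine h1.trans ((le_of_eq ?_).trans (mul_le_mul_of_nonneg_left h2 zero_le_two))
  rw [mul_pow _ τ]
  ring

theorem ringDist_le {L : ℕ} [NeZero L] {x y : ℤ} {r : ℕ} (h : (x - y).natAbs ≤ r) :
    ringDist (x : ZMod L) (y : ZMod L) ≤ r := by
  refine le_trans (ZMod.natAbs_min_of_le_div_two L _ (x - y) ?_ (ZMod.natAbs_valMinAbs_le _)) h
  rw [ZMod.coe_valMinAbs]
  push_cast
  rfl

theorem norm_commutator_le {n : Type*} [Fintype n] [DecidableEq n] (A B C : Matrix n n ℂ)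
    (hC : Commute B C) (h : ‖C‖ ≤ 1) : ‖A * C - C * A‖ ≤ 2 * ‖A - B‖ := by
  have : A * C - C * A = (A - B) * C - C * (A - B) := by
    rw [sub_mul, mul_sub, hC.eq]
    abel
  rw [this]
  calc ‖(A - B) * C - C * (A - B)‖ ≤ ‖A - B‖ * ‖C‖ + ‖C‖ * ‖A - B‖ :=
        (norm_sub_le _ _).trans (add_le_add (norm_mul_le _ _) (norm_mul_le _ _))
    _ ≤ ‖A - B‖ * 1 + 1 * ‖A - B‖ := by gcongr
    _ = 2 * ‖A - B‖ := by ring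

/-- The evolution of an observable under the Hamiltonian of a window stays in the window. -/
theorem conj_evolution_window (Φ : Interaction) {L r : ℕ} [NeZero L] (hr : 2 * r + 1 ≤ L) (j : ℤ)
    (O : Op Unit) (τ : ℝ) :
    (evolution (embed (windowMap j r L) (windowHam Φ j r)) τ).conjTranspose *
      single (j : ZMod L) O * evolution (embed (windowMap j r L) (windowHam Φ j r)) τ =
    embed (windowMap j r L) ((evolution (windowHam Φ j r) τ).conjTranspose *
      embed (fun _ : Unit => ⟨j, self_mem_window j r⟩) O * evolution (windowHam Φ j r) τ) := by
  have hinj := windowMap_injective (j := j) hr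
  rw [single_eq_embed_windowMap j hr, evolution_embed hinj, embed_mul hinj, embed_mul hinj,
    embed_conjTranspose]

/-- The Lieb-Robinson bound, with a prefactor that does not depend on the time. -/
theorem liebRobinsonBound (g : ℝ) (k dH : ℕ) {τ : ℝ} (hτ : 0 ≤ τ) :
    LiebRobinsonBound g k dH (2 * (2 * dH * |g|) * Real.exp (dH + 1 : ℕ) + 1) 1 τ
      (4 * Real.exp (dH + 2 : ℕ)) := by
  intro Φ hΦ L _ hL i j O O' hO hO'
  obtain ⟨x, -, -, rfl⟩ := exists_int_rep 0 i
  set v := 2 * (2 * dH * |g|) * Real.exp (dH + 1 : ℕ) + 1 with hv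
  have hO'j : ‖single j O'‖ ≤ 1 := (norm_single_le _ _).trans hO'.norm_le
  rw [opNorm_eq_norm]
  set A := (Φ.target dH τ L).conjTranspose * single (x : ZMod L) O * Φ.target dH τ L with hA
  have hvτ : 0 ≤ v * τ := by positivity
  rcases Nat.eq_zero_or_pos (ringDist (x : ZMod L) j) with h0 | hpos
  · have hA1 : ‖A‖ ≤ 1 :=
      (norm_conj_le (evolution_mem_unitary (hamPBC_isHermitian Φ dH L) τ) _).trans
        ((norm_single_le _ _).trans hO.norm_le)
    calc _ ≤ 2 * ‖A - 0‖ := norm_commutator_le A 0 _ (Commute.zero_left _) hO'j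
      _ ≤ 4 * 1 * 1 := by rw [sub_zero]; linarith
      _ ≤ _ := by
        gcongr
        · exact Real.one_le_exp (by positivity)
        · refine Real.one_le_exp ?_
          rw [h0]
          simpa using hvτ
  · obtain ⟨r, hr⟩ : ∃ r, ringDist (x : ZMod L) j = r + 1 := ⟨_, (Nat.sub_add_cancel hpos).symm⟩
    have hrL : 2 * r + 1 ≤ L := by
      have := ZMod.natAbs_valMinAbs_le ((x : ZMod L) - j)
      rw [ringDist] at hr
      omega
    have hne : ∀ (y : window x r) (_ : Unit), windowMap x r L y ≠ j := by
      rintro ⟨y, hy⟩ - rfl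
      rw [Finset.mem_Icc] at hy
      have := ringDist_le (L := L) (x := x) (y := y) (r := r) (by omega)
      change ringDist (x : ZMod L) (y : ZMod L) = r + 1 at hr
      omega
    have hbound := norm_target_sub_window_le_exp hΦ (by omega) hrL x hO.norm_le hτ one_pos
    refine (norm_commutator_le A _ _ ?_ hO'j).trans
      ((mul_le_mul_of_nonneg_left hbound zero_le_two).trans ?_)
    · rw [conj_evolution_window Φ hrL]
      exact commute_embed hne _ _
    · rw [hr]
      simp only [div_one]
      rw [← mul_assoc, ← Real.exp_add, ← Real.exp_add, mul_assoc 4, ← Real.exp_add]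
      norm_num only
      refine mul_le_mul_of_nonneg_left (Real.exp_le_exp.2 ?_) (by norm_num)
      rw [hv]
      push_cast
      linarith

/-- The error of restricting the Hamiltonian decays exponentially in `l₀` at an arbitrary rate. -/
theorem restrictionErrorLE (g : ℝ) (k dH : ℕ) {v ξ τ : ℝ} (hv : 0 ≤ v) (hξ : 0 < ξ) (hτ : 0 ≤ τ) :
    ∃ C' : ℝ, 0 ≤ C' ∧ ∀ Φ : Interaction, Φ.IsLocal g k dH → ∀ l₀ : ℝ, 0 ≤ l₀ →
      Φ.RestrictionErrorLE dH τ (restrictionSize dH v τ l₀) (epsLR dH v ξ τ l₀ C') := by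
  set D := Real.exp ((dH + 1 : ℕ) / ξ) *
    Real.exp (2 * (2 * dH * |g|) * τ * Real.exp ((dH + 1 : ℕ) / ξ)) with hD
  refine ⟨2 * (D * Real.exp (1 / ξ)) / ξ, by positivity, ?_⟩
  intro Φ hΦ l₀ hl₀ L _ hL j O hO
  have hvτ : 0 ≤ v * τ := by positivity
  set L' := restrictionSize dH v τ l₀ with hL'
  have hL'0 : 0 ≤ L' := by rw [hL', restrictionSize]; positivity
  have hhalf : L' / 2 = l₀ + dH + v * τ := by rw [hL', restrictionSize]; ring
  set r := ⌊L' / 2⌋₊ with hr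
  have hr1 : (r : ℝ) ≤ L' / 2 := Nat.floor_le (by positivity)
  have hr2 : L' / 2 < r + 1 := Nat.lt_floor_add_one _
  have hrL : 2 * r + 1 ≤ L := by
    have : (2 * r + 1 : ℝ) ≤ L := by linarith
    exact_mod_cast this
  have hdL : dH < L := by
    have : (dH : ℝ) < L := by linarith
    exact_mod_cast this
  rw [opNorm_eq_norm, hamRestricted_eq_embed Φ hL'0 j hrL]
  refine (norm_target_sub_window_le_exp hΦ hdL hrL j hO.norm_le hτ hξ).trans ?_
  rw [epsLR_eq dH hξ, ← hD]
  have hexp : Real.exp (-(r / ξ)) ≤ Real.exp (1 / ξ) * Real.exp (-(l₀ / ξ)) := by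
    rw [← Real.exp_add, Real.exp_le_exp, ← neg_div, ← neg_div, ← add_div]
    gcongr
    have : (0 : ℝ) ≤ dH := by positivity
    linarith
  calc 2 * (D * Real.exp (-(r / ξ)))
      ≤ 2 * (D * (Real.exp (1 / ξ) * Real.exp (-(l₀ / ξ)))) := by gcongr
    _ = _ := by field_simp

end Bounds

/-! ### Pauli matrices -/

/-- The identity and the three Pauli matrices. -/
def pauli : Fin 4 → Matrix (Fin 2) (Fin 2) ℂ :=
  ![1, !![0, 1; 1, 0], !![0, -Complex.I; Complex.I, 0], !![1, 0; 0, -1]]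

/-- The Pauli matrices as one-qubit operators. -/
def pauliOp (c : Fin 4) : Op Unit := (pauli c).submatrix (fun s => s ()) (fun s => s ())

theorem pauli_isHermitian (c : Fin 4) : (pauli c).IsHermitian := by
  fin_cases c <;> ext a b <;> fin_cases a <;> fin_cases b <;> simp [pauli]

theorem pauli_mul_self (c : Fin 4) : pauli c * pauli c = 1 := by
  fin_cases c <;> ext a b <;> fin_cases a <;> fin_cases b <;>
    simp [pauli, Matrix.mul_apply, Fin.sum_univ_two]

/-- The twirl over the Pauli matrices is the projection onto the Bell state. -/
theorem sum_pauli_mul_conj (a b a' b' : Fin 2) :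
    ∑ c, pauli c a a' * (starRingEnd ℂ) (pauli c b b') =
      2 * ((if a = b then 1 else 0) * (if a' = b' then 1 else 0)) := by
  fin_cases a <;> fin_cases b <;> fin_cases a' <;> fin_cases b' <;>
    simp [pauli, Fin.sum_univ_four] <;> norm_num

/-- The Pauli matrices are an orthogonal basis; this is the completeness relation. -/
theorem sum_pauli_mul_conj' (a b a' b' : Fin 2) :
    ∑ c, pauli c a b * (starRingEnd ℂ) (pauli c a' b') =
      2 * ((if a = a' then 1 else 0) * (if b = b' then 1 else 0)) := by
  fin_cases a <;> fin_cases b <;> fin_cases a' <;> fin_cases b' <;>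
    simp [pauli, Fin.sum_univ_four] <;> norm_num

theorem pauliOp_isHermitian (c : Fin 4) : (pauliOp c).IsHermitian :=
  (pauli_isHermitian c).submatrix _

theorem pauliOp_mul_self (c : Fin 4) : pauliOp c * pauliOp c = 1 := by
  have h := Matrix.submatrix_mul_equiv (pauli c) (pauli c) (fun s : Unit → Fin 2 => s ())
    (Equiv.funUnique Unit (Fin 2)) (fun s : Unit → Fin 2 => s ())
  rw [pauli_mul_self] at h
  refine Eq.trans h ?_
  ext s t
  simp only [Matrix.submatrix_apply, Matrix.one_apply]
  exact if_congr ⟨fun h => funext fun _ => h, fun h => by rw [h]⟩ rfl rfl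

theorem isNormalizedObservable_pauliOp (c : Fin 4) : IsNormalizedObservable (pauliOp c) := by
  refine ⟨pauliOp_isHermitian c, ?_⟩
  rw [opNorm_eq_norm]
  refine CStarRing.norm_of_mem_unitary ?_
  rw [Unitary.mem_iff, Matrix.star_eq_conjTranspose, (pauliOp_isHermitian c).eq]
  exact ⟨pauliOp_mul_self c, pauliOp_mul_self c⟩

section Cost

variable {ι : Type*} [Fintype ι] [DecidableEq ι]

theorem single_apply (j : ι) (O : Op Unit) (s t : ι → Fin 2)
    [Decidable (∀ i, i ≠ j → s i = t i)] :
    single j O s t = if ∀ i, i ≠ j → s i = t i then O (fun _ => s j) (fun _ => t j) else 0 := by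
  classical
  rw [single, embed_apply]
  refine if_congr ?_ rfl rfl
  simp [eq_comm]

theorem single_pauliOp_zero (j : ι) : single j (pauliOp 0) = 1 := by
  have : pauliOp 0 = 1 := by
    ext s t
    simp only [pauliOp, pauli, Matrix.submatrix_apply, Matrix.cons_val_zero, Matrix.one_apply]
    exact if_congr ⟨fun h => funext fun _ => h, fun h => by rw [h]⟩ rfl rfl
  rw [this, single, embed_one]

/-! ### The cost functions in terms of Heisenberg evolutions -/

theorem inv_sqrt_two_mul_self : (1 / (Real.sqrt 2 : ℂ)) * (1 / (Real.sqrt 2 : ℂ)) = 1 / 2 := by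
  rw [div_mul_div_comm, ← Complex.ofReal_mul, Real.mul_self_sqrt zero_le_two]
  norm_num

/-- The vector `(U ⊗ V*) |Φ₊⟩`, which is proportional to the matrix `U V†`. -/
theorem kronecker_mulVec_bellState (U V : Op ι) (p : (ι → Fin 2) × (ι → Fin 2)) :
    ((U ⊗ₖ V.map (starRingEnd ℂ)).mulVec (bellState ι)) p =
      (1 / (Real.sqrt 2 : ℂ)) ^ Fintype.card ι * (U * V.conjTranspose) p.1 p.2 := by
  have hbell : ∀ q : (ι → Fin 2) × (ι → Fin 2), bellState ι q =
      if q.1 = q.2 then (1 / (Real.sqrt 2 : ℂ)) ^ Fintype.card ι else 0 := by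
    intro q
    rw [bellState]
    split_ifs with h
    · simp [h]
    · obtain ⟨i, hi⟩ := Function.ne_iff.1 h
      exact Finset.prod_eq_zero (Finset.mem_univ i) (if_neg hi)
  rw [Matrix.mulVec, dotProduct, Fintype.sum_prod_type, Matrix.mul_apply, Finset.mul_sum]
  refine Finset.sum_congr rfl fun s _ => ?_
  simp only [hbell, Matrix.kroneckerMap_apply, mul_ite, mul_zero, Finset.sum_ite_eq,
    Finset.mem_univ, if_true, Matrix.map_apply, Matrix.conjTranspose_apply]
  rw [starRingEnd_apply]
  ring

theorem rhoAB_eq_vecMulVec (U V : Op ι) :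
    rhoAB U V = Matrix.vecMulVec ((U ⊗ₖ V.map (starRingEnd ℂ)).mulVec (bellState ι))
      (star ((U ⊗ₖ V.map (starRingEnd ℂ)).mulVec (bellState ι))) := by
  rw [rhoAB, Matrix.mul_vecMulVec, Matrix.vecMulVec_mul, Matrix.star_mulVec]

theorem bellProj_apply_eq_sum_pauli (j : ι) (p q : (ι → Fin 2) × (ι → Fin 2)) :
    bellProj j p q = 1 / 4 * ∑ c, single j (pauliOp c) p.1 q.1 *
      (starRingEnd ℂ) (single j (pauliOp c) p.2 q.2) := by
  classical
  simp only [bellProj, Matrix.of_apply, single_apply]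
  by_cases h1 : ∀ i, i ≠ j → p.1 i = q.1 i
  · by_cases h2 : ∀ i, i ≠ j → p.2 i = q.2 i
    · rw [if_pos fun i hi => ⟨h1 i hi, h2 i hi⟩]
      simp only [if_pos h1, if_pos h2, pauliOp, Matrix.submatrix_apply]
      rw [sum_pauli_mul_conj]
      have := inv_sqrt_two_mul_self
      split_ifs <;> simp_all
      norm_num
    · rw [if_neg fun h => h2 fun i hi => (h i hi).2]
      simp [if_neg h2]
  · rw [if_neg fun h => h1 fun i hi => (h i hi).1]
    simp [if_neg h1]

theorem norm_inv_sqrt_two_pow (n : ℕ) :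
    (1 / (Real.sqrt 2 : ℂ)) ^ n * (starRingEnd ℂ) ((1 / (Real.sqrt 2 : ℂ)) ^ n) = 1 / 2 ^ n := by
  have : (starRingEnd ℂ) (1 / (Real.sqrt 2 : ℂ)) = 1 / (Real.sqrt 2 : ℂ) := by
    rw [map_div₀, map_one, Complex.conj_ofReal]
  rw [map_pow, this, ← mul_pow, inv_sqrt_two_mul_self, div_pow, one_pow]

theorem trace_kronecker_mul_rhoAB (U V X Y : Op ι) :
    ((X ⊗ₖ Y.map (starRingEnd ℂ)) * rhoAB U V).trace =
      ((U.conjTranspose * X * U) * (V.conjTranspose * Y.conjTranspose * V)).trace /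
        2 ^ Fintype.card ι := by
  set W := U * V.conjTranspose with hW
  have hc : ((U.conjTranspose * X * U) * (V.conjTranspose * Y.conjTranspose * V)).trace =
      (X * W * Y.conjTranspose * W.conjTranspose).trace := by
    rw [hW, Matrix.conjTranspose_mul, Matrix.conjTranspose_conjTranspose]
    simp only [Matrix.mul_assoc]
    rw [Matrix.trace_mul_comm]
    simp only [Matrix.mul_assoc]
  rw [hc, div_eq_mul_one_div, ← norm_inv_sqrt_two_pow, rhoAB_eq_vecMulVec]
  simp only [Matrix.trace, Matrix.diag]
  rw [Fintype.sum_prod_type, Finset.sum_mul]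
  refine Finset.sum_congr rfl fun s _ => ?_
  rw [Matrix.mul_apply, Finset.sum_mul]
  refine Finset.sum_congr rfl fun t _ => ?_
  rw [Matrix.mul_apply, Matrix.mul_apply, Fintype.sum_prod_type, Finset.sum_comm, Finset.sum_mul,
    Finset.sum_mul]
  refine Finset.sum_congr rfl fun t' _ => ?_
  rw [Matrix.mul_apply, Finset.sum_mul, Finset.sum_mul, Finset.sum_mul]
  refine Finset.sum_congr rfl fun s' _ => ?_
  simp only [Matrix.kroneckerMap_apply, Matrix.map_apply, Matrix.vecMulVec_apply, Pi.star_apply,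
    kronecker_mulVec_bellState, RCLike.star_def, map_mul, Matrix.conjTranspose_apply, ← hW]
  ring

/-- The local cost compares the Heisenberg evolutions of the Pauli matrices at the site. -/
theorem costLHSTAt_eq (j : ι) (U V : Op ι) :
    costLHSTAt j U V = 1 - 1 / 4 * ∑ c,
      (((U.conjTranspose * single j (pauliOp c) * U) *
        (V.conjTranspose * single j (pauliOp c) * V)).trace / 2 ^ Fintype.card ι).re := by
  have hproj : bellProj j = (1 / 4 : ℂ) • ∑ c, (single j (pauliOp c) : Op ι) ⊗ₖ
      (single j (pauliOp c) : Op ι).map (starRingEnd ℂ) := by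
    ext p q
    simp only [bellProj_apply_eq_sum_pauli, Matrix.smul_apply, Matrix.sum_apply,
      Matrix.kroneckerMap_apply, Matrix.map_apply, smul_eq_mul]
  rw [costLHSTAt, hproj, Matrix.smul_mul, Finset.sum_mul, Matrix.trace_smul, Matrix.trace_sum,
    ← Complex.re_sum, smul_eq_mul, show (1 / 4 : ℂ) = ((1 / 4 : ℝ) : ℂ) by norm_num,
    Complex.re_ofReal_mul]
  simp only [trace_kronecker_mul_rhoAB, single_conjTranspose, (pauliOp_isHermitian _).eq]

theorem abs_re_trace_div_le (M : Op ι) : |(M.trace / 2 ^ Fintype.card ι).re| ≤ ‖M‖ := by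
  have hentry : ∀ s, ‖M s s‖ ≤ ‖M‖ := by
    intro s
    have h := Matrix.l2_opNorm_mulVec M (EuclideanSpace.single s 1)
    rw [PiLp.norm_single, norm_one, mul_one] at h
    refine le_trans ?_ h
    refine le_trans (le_of_eq ?_) (PiLp.norm_apply_le _ s)
    simp
  refine (Complex.abs_re_le_norm _).trans ?_
  rw [norm_div, norm_pow, Complex.norm_ofNat, div_le_iff₀ (by positivity)]
  calc ‖M.trace‖ ≤ ∑ s, ‖M s s‖ := norm_sum_le _ _
    _ ≤ ∑ _s : ι → Fin 2, ‖M‖ := Finset.sum_le_sum fun s _ => hentry s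
    _ = ‖M‖ * 2 ^ Fintype.card ι := by
      rw [Finset.sum_const, Finset.card_univ, nsmul_eq_mul, Fintype.card_fun, Fintype.card_fin]
      push_cast
      ring

/-- Replacing the evolved Pauli matrices in the local cost changes it by at most `3 / 4` of the
error: the identity contributes no error. -/
theorem abs_costLHSTAt_sub_le (j : ι) {U V : Op ι} (hV : V ∈ unitary (Op ι)) (A : Fin 4 → Op ι)
    {ε : ℝ} (h0 : A 0 = U.conjTranspose * single j (pauliOp 0) * U)
    (h : ∀ c, c ≠ 0 → ‖U.conjTranspose * single j (pauliOp c) * U - A c‖ ≤ ε) :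
    |costLHSTAt j U V - (1 - 1 / 4 * ∑ c,
      ((A c * (V.conjTranspose * single j (pauliOp c) * V)).trace / 2 ^ Fintype.card ι).re)| ≤
      3 / 4 * ε := by
  have hterm : ∀ c, |((A c * (V.conjTranspose * single j (pauliOp c) * V)).trace /
      2 ^ Fintype.card ι).re - (((U.conjTranspose * single j (pauliOp c) * U) *
        (V.conjTranspose * single j (pauliOp c) * V)).trace / 2 ^ Fintype.card ι).re| ≤
      ‖U.conjTranspose * single j (pauliOp c) * U - A c‖ := by
    intro c
    rw [← Complex.sub_re, ← sub_div, ← Matrix.trace_sub, ← sub_mul]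
    refine (abs_re_trace_div_le _).trans ((norm_mul_le _ _).trans ?_)
    rw [norm_sub_rev]
    refine mul_le_of_le_one_right (norm_nonneg _) ?_
    exact (norm_conj_le hV _).trans ((norm_single_le _ _).trans
      (isNormalizedObservable_pauliOp c).norm_le)
  rw [costLHSTAt_eq, sub_sub_sub_cancel_left, ← mul_sub, ← Finset.sum_sub_distrib, abs_mul,
    Fin.sum_univ_four]
  have e0 := hterm 0
  have hzero : ‖U.conjTranspose * single j (pauliOp 0) * U - A 0‖ = 0 := by
    rw [h0, sub_self, norm_zero]
  rw [hzero] at e0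
  have e1 := (hterm 1).trans (h 1 (by decide))
  have e2 := (hterm 2).trans (h 2 (by decide))
  have e3 := (hterm 3).trans (h 3 (by decide))
  rw [abs_of_nonneg (by norm_num : (0 : ℝ) ≤ 1 / 4)]
  rw [abs_le] at e0 e1 e2 e3
  have hle : ∀ x : ℝ, -(3 * ε) ≤ x → x ≤ 3 * ε → 1 / 4 * |x| ≤ 3 / 4 * ε := fun x h1 h2 => by
    linarith [abs_le.2 ⟨h1, h2⟩]
  refine hle _ ?_ ?_
  · linarith [e0.1, e1.1, e2.1, e3.1]
  · linarith [e0.2, e1.2, e2.2, e3.2]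

/-! ### The global and the local cost -/

/-- The tensor products of Bell states, an orthonormal basis of the `2 L` qubits. -/
def bellBasis (σ : ι → Fin 4) (p : (ι → Fin 2) × (ι → Fin 2)) : ℂ :=
  ∏ i, pauli (σ i) (p.1 i) (p.2 i) * (1 / (Real.sqrt 2 : ℂ))

/-- The outcome probabilities of the Bell measurement of the pairs in the state `ρ_AB(U, V)`. -/
def bellProb (U V : Op ι) (σ : ι → Fin 4) : ℝ :=
  ‖∑ p, (starRingEnd ℂ) (bellBasis σ p) *
    ((U ⊗ₖ V.map (starRingEnd ℂ)).mulVec (bellState ι)) p‖ ^ 2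

theorem bellProb_nonneg (U V : Op ι) (σ : ι → Fin 4) : 0 ≤ bellProb U V σ := by
  unfold bellProb
  positivity

theorem sum_bellBasis_mul_conj (T : ι → Finset (Fin 4)) (p q : (ι → Fin 2) × (ι → Fin 2)) :
    ∑ σ ∈ Fintype.piFinset T, bellBasis σ p * (starRingEnd ℂ) (bellBasis σ q) =
      ∏ i, ∑ c ∈ T i, 1 / 2 * (pauli c (p.1 i) (p.2 i) *
        (starRingEnd ℂ) (pauli c (q.1 i) (q.2 i))) := by
  rw [Finset.prod_univ_sum]
  refine Finset.sum_congr rfl fun σ _ => ?_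
  rw [bellBasis, bellBasis, map_prod, ← Finset.prod_mul_distrib]
  refine Finset.prod_congr rfl fun i _ => ?_
  have h1 : (starRingEnd ℂ) (1 / (Real.sqrt 2 : ℂ)) = 1 / (Real.sqrt 2 : ℂ) := by
    rw [map_div₀, map_one, Complex.conj_ofReal]
  rw [map_mul, h1, ← inv_sqrt_two_mul_self]
  ring

theorem sum_bellBasis_univ (p q : (ι → Fin 2) × (ι → Fin 2)) :
    ∑ σ, bellBasis σ p * (starRingEnd ℂ) (bellBasis σ q) = if p = q then 1 else 0 := by
  have h := sum_bellBasis_mul_conj (fun _ : ι => Finset.univ) p q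
  rw [Fintype.piFinset_univ] at h
  rw [h]
  simp only [← Finset.mul_sum, sum_pauli_mul_conj']
  by_cases hpq : p = q
  · simp [hpq]
  · rw [if_neg hpq]
    obtain ⟨i, hi⟩ : ∃ i, ¬ (p.1 i = q.1 i ∧ p.2 i = q.2 i) := by
      by_contra hall
      push Not at hall
      exact hpq (Prod.ext (funext fun i => (hall i).1) (funext fun i => (hall i).2))
    refine Finset.prod_eq_zero (Finset.mem_univ i) ?_
    by_cases h1 : p.1 i = q.1 i
    · simp [show p.2 i ≠ q.2 i from fun h2 => hi ⟨h1, h2⟩]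
    · simp [h1]

theorem bellProj_eq_sum_bellBasis (j : ι) (p q : (ι → Fin 2) × (ι → Fin 2)) :
    bellProj j p q = ∑ σ with σ j = 0, bellBasis σ p * (starRingEnd ℂ) (bellBasis σ q) := by
  have hset : (Finset.univ.filter fun σ : ι → Fin 4 => σ j = 0) =
      Fintype.piFinset fun i => if i = j then {0} else Finset.univ := by
    ext σ
    simp only [Finset.mem_filter, Finset.mem_univ, true_and, Fintype.mem_piFinset]
    constructor
    · intro h i
      split_ifs with hi
      · simpa [hi] using h
      · simp
    · intro h
      simpa using h j
  rw [hset, sum_bellBasis_mul_conj, ← Finset.mul_prod_erase _ _ (Finset.mem_univ j), bellProj,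
    Matrix.of_apply]
  have hoff : ∏ i ∈ Finset.univ.erase j, ∑ c ∈ (if i = j then {0} else Finset.univ),
      1 / 2 * (pauli c (p.1 i) (p.2 i) * (starRingEnd ℂ) (pauli c (q.1 i) (q.2 i))) =
      if ∀ i, i ≠ j → p.1 i = q.1 i ∧ p.2 i = q.2 i then (1 : ℂ) else 0 := by
    have : ∀ i ∈ Finset.univ.erase j, ∑ c ∈ (if i = j then {0} else Finset.univ),
        1 / 2 * (pauli c (p.1 i) (p.2 i) * (starRingEnd ℂ) (pauli c (q.1 i) (q.2 i))) =
        if p.1 i = q.1 i ∧ p.2 i = q.2 i then (1 : ℂ) else 0 := by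
      intro i hi
      rw [if_neg (Finset.ne_of_mem_erase hi), ← Finset.mul_sum, sum_pauli_mul_conj', ite_and]
      split_ifs <;> norm_num
    rw [Finset.prod_congr rfl this]
    split_ifs with h
    · exact Finset.prod_eq_one fun i hi => if_pos (h i (Finset.ne_of_mem_erase hi))
    · push Not at h
      obtain ⟨i, hi, hi'⟩ := h
      refine Finset.prod_eq_zero (Finset.mem_erase.2 ⟨hi, Finset.mem_univ i⟩) (if_neg ?_)
      rintro ⟨h1, h2⟩
      exact hi' h1 h2
  rw [hoff, if_pos rfl, Finset.sum_singleton, mul_boole]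
  refine if_congr Iff.rfl ?_ rfl
  have := inv_sqrt_two_mul_self
  simp only [pauli, Matrix.cons_val_zero, Matrix.one_apply]
  split_ifs <;> simp_all

theorem sum_filter_bellProb (U V : Op ι) (B : Matrix ((ι → Fin 2) × (ι → Fin 2))
    ((ι → Fin 2) × (ι → Fin 2)) ℂ) (T : Finset (ι → Fin 4))
    (hB : ∀ p q, B p q = ∑ σ ∈ T, bellBasis σ p * (starRingEnd ℂ) (bellBasis σ q)) :
    (B * rhoAB U V).trace = ((∑ σ ∈ T, bellProb U V σ : ℝ) : ℂ) := by
  rw [rhoAB_eq_vecMulVec]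
  set ψ := (U ⊗ₖ V.map (starRingEnd ℂ)).mulVec (bellState ι) with hψ
  have hprob : ∀ σ, ((bellProb U V σ : ℝ) : ℂ) =
      (∑ p, (starRingEnd ℂ) (bellBasis σ p) * ψ p) *
        (∑ p, bellBasis σ p * (starRingEnd ℂ) (ψ p)) := by
    intro σ
    rw [bellProb, Complex.ofReal_pow, ← Complex.mul_conj', map_sum]
    simp only [map_mul, Complex.conj_conj, hψ]
  rw [Complex.ofReal_sum]
  simp only [hprob, Matrix.trace, Matrix.diag, Matrix.mul_apply, Matrix.vecMulVec_apply,
    Pi.star_apply, RCLike.star_def, hB, Finset.sum_mul, Finset.mul_sum]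
  rw [Finset.sum_comm]
  simp only [Finset.sum_comm (s := Finset.univ) (t := T)]
  refine Finset.sum_congr rfl fun σ _ => ?_
  rw [Finset.sum_comm]
  exact Finset.sum_congr rfl fun p _ => Finset.sum_congr rfl fun q _ => by ring

theorem costLHSTAt_eq_sum_bellProb (j : ι) (U V : Op ι) :
    costLHSTAt j U V = 1 - ∑ σ with σ j = 0, bellProb U V σ := by
  rw [costLHSTAt, sum_filter_bellProb U V _ _ (bellProj_eq_sum_bellBasis j), Complex.ofReal_re]

theorem sum_bellProb {U V : Op ι} (hU : U ∈ unitary (Op ι)) (hV : V ∈ unitary (Op ι)) :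
    ∑ σ, bellProb U V σ = 1 := by
  have h := sum_filter_bellProb U V 1 Finset.univ fun p q => by
    rw [sum_bellBasis_univ, Matrix.one_apply]
  have hW : (U * V.conjTranspose) * (U * V.conjTranspose).conjTranspose = 1 := by
    have h1 : U * U.conjTranspose = 1 := (Unitary.mem_iff.1 hU).2
    have h2 : V.conjTranspose * V = 1 := (Unitary.mem_iff.1 hV).1
    rw [Matrix.conjTranspose_mul, Matrix.conjTranspose_conjTranspose, Matrix.mul_assoc,
      ← Matrix.mul_assoc _ V, h2, Matrix.one_mul, h1]
  rw [one_mul, rhoAB_eq_vecMulVec] at h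
  have htr : (1 : ℂ) = ((∑ σ, bellProb U V σ : ℝ) : ℂ) := by
    rw [← h]
    simp only [Matrix.trace, Matrix.diag, Matrix.vecMulVec_apply, Pi.star_apply, RCLike.star_def,
      kronecker_mulVec_bellState, map_mul]
    set W := U * V.conjTranspose with hWdef
    have htr1 : ∑ s, ∑ t, W s t * (starRingEnd ℂ) (W s t) = 2 ^ Fintype.card ι := by
      have := congrArg Matrix.trace hW
      rw [Matrix.trace_one] at this
      simp only [Matrix.trace, Matrix.diag, Matrix.mul_apply, Matrix.conjTranspose_apply,
        RCLike.star_def] at this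
      rw [this]
      simp
    have hn := norm_inv_sqrt_two_pow (Fintype.card ι)
    calc (1 : ℂ) = 1 / 2 ^ Fintype.card ι * ∑ s, ∑ t, W s t * (starRingEnd ℂ) (W s t) := by
          rw [htr1, one_div_mul_cancel (pow_ne_zero _ two_ne_zero)]
      _ = _ := by
          rw [Fintype.sum_prod_type, ← hn, Finset.mul_sum]
          refine Finset.sum_congr rfl fun s _ => ?_
          rw [Finset.mul_sum]
          exact Finset.sum_congr rfl fun t _ => by ring
  exact_mod_cast htr.symm

theorem costHST_eq_bellProb (U V : Op ι) : costHST U V = 1 - bellProb U V 0 := by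
  rw [costHST]
  congr 1
  have h0 : ∀ p : (ι → Fin 2) × (ι → Fin 2), (starRingEnd ℂ) (bellBasis 0 p) =
      if p.1 = p.2 then (1 / (Real.sqrt 2 : ℂ)) ^ Fintype.card ι else 0 := by
    intro p
    have h1 : (starRingEnd ℂ) (1 / (Real.sqrt 2 : ℂ)) = 1 / (Real.sqrt 2 : ℂ) := by
      rw [map_div₀, map_one, Complex.conj_ofReal]
    rw [bellBasis, map_prod]
    simp only [map_mul, h1, Pi.zero_apply, pauli, Matrix.cons_val_zero, Matrix.one_apply]
    split_ifs with h
    · simp [h]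
    · obtain ⟨i, hi⟩ := Function.ne_iff.1 h
      exact Finset.prod_eq_zero (Finset.mem_univ i) (by simp [hi])
  have hamp : ∑ p, (starRingEnd ℂ) (bellBasis 0 p) *
      ((U ⊗ₖ V.map (starRingEnd ℂ)).mulVec (bellState ι)) p =
      1 / 2 ^ Fintype.card ι * (U * V.conjTranspose).trace := by
    simp only [h0, kronecker_mulVec_bellState, Fintype.sum_prod_type, ite_mul, zero_mul,
      Finset.sum_ite_eq, Finset.mem_univ, if_true]
    rw [← Finset.mul_sum, ← Finset.mul_sum, ← mul_assoc, ← mul_pow, inv_sqrt_two_mul_self, div_pow,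
      one_pow]
    rfl
  have htr : ‖(U * V.conjTranspose).trace‖ = ‖(U.conjTranspose * V).trace‖ := by
    rw [Matrix.trace_mul_comm, ← norm_star, ← Matrix.trace_conjTranspose,
      Matrix.conjTranspose_mul, Matrix.conjTranspose_conjTranspose]
  rw [bellProb, hamp, norm_mul, htr, mul_pow]
  congr 1
  rw [norm_div, norm_one, norm_pow, Complex.norm_ofNat, div_pow, one_pow, ← pow_mul,
    mul_comm, pow_mul]
  norm_num

theorem costLHSTAt_le_costHST (j : ι) (U V : Op ι) : costLHSTAt j U V ≤ costHST U V := by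
  rw [costLHSTAt_eq_sum_bellProb, costHST_eq_bellProb]
  refine sub_le_sub_left ?_ _
  exact Finset.single_le_sum (f := bellProb U V) (fun σ _ => bellProb_nonneg U V σ)
    (Finset.mem_filter.2 ⟨Finset.mem_univ 0, rfl⟩)

theorem costLHST_le_costHST [Nonempty ι] (U V : Op ι) : costLHST U V ≤ costHST U V := by
  rw [costLHST, div_mul_eq_mul_div, one_mul, div_le_iff₀ (by exact_mod_cast Fintype.card_pos)]
  calc ∑ j, costLHSTAt j U V ≤ ∑ _j : ι, costHST U V :=
        Finset.sum_le_sum fun j _ => costLHSTAt_le_costHST j U V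
    _ = costHST U V * Fintype.card ι := by simp [mul_comm]

/-- A configuration of Bell states differs from the reference one at some site: the union bound. -/
theorem costHST_le_card_mul_costLHST [Nonempty ι] {U V : Op ι} (hU : U ∈ unitary (Op ι))
    (hV : V ∈ unitary (Op ι)) : costHST U V ≤ Fintype.card ι * costLHST U V := by
  have hne : (Fintype.card ι : ℝ) ≠ 0 := by exact_mod_cast Fintype.card_ne_zero
  rw [costLHST, ← mul_assoc, mul_one_div_cancel hne, one_mul, costHST_eq_bellProb]
  have hj : ∀ j, costLHSTAt j U V = ∑ σ, if σ j ≠ 0 then bellProb U V σ else 0 := by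
    intro j
    rw [costLHSTAt_eq_sum_bellProb, ← sum_bellProb hU hV, ← Finset.sum_filter,
      ← Finset.sum_filter_add_sum_filter_not Finset.univ (fun σ : ι → Fin 4 => σ j = 0)]
    ring
  simp only [hj]
  rw [Finset.sum_comm, ← sum_bellProb hU hV,
    ← Finset.add_sum_erase _ _ (Finset.mem_univ (0 : ι → Fin 4)), add_sub_cancel_left]
  refine (Finset.sum_le_sum fun σ hσ => ?_).trans
    (Finset.sum_le_sum_of_subset_of_nonneg (Finset.erase_subset 0 Finset.univ) fun σ _ _ => ?_)
  · obtain ⟨j, hj⟩ := Function.ne_iff.1 (Finset.ne_of_mem_erase hσ)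
    refine le_trans (le_of_eq (if_pos hj).symm) (Finset.single_le_sum
      (f := fun j => if σ j ≠ 0 then bellProb U V σ else 0) (fun i _ => ?_) (Finset.mem_univ j))
    split_ifs
    exacts [bellProb_nonneg U V σ, le_rfl]
  · refine Finset.sum_nonneg fun i _ => ?_
    split_ifs
    exacts [bellProb_nonneg U V σ, le_rfl]

end Cost

/-! ### Brickwork layers -/

section Layers

theorem embed_mem_unitary {κ ι : Type*} [Fintype κ] [DecidableEq κ] [Fintype ι] [DecidableEq ι]
    {f : κ → ι} (hf : f.Injective) {A : Op κ} (hA : A ∈ unitary (Op κ)) :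
    embed f A ∈ unitary (Op ι) := by
  rw [Unitary.mem_iff, Matrix.star_eq_conjTranspose] at hA ⊢
  rw [← embed_conjTranspose, ← embed_mul hf, ← embed_mul hf, hA.1, hA.2, embed_one]
  exact ⟨rfl, rfl⟩

theorem list_prod_mem_unitary {α : Type*} {n : Type*} [Fintype n] [DecidableEq n] (l : List α)
    {f : α → Matrix n n ℂ} (h : ∀ a ∈ l, f a ∈ unitary (Matrix n n ℂ)) :
    (l.map f).prod ∈ unitary (Matrix n n ℂ) :=
  Submonoid.list_prod_mem _ fun x hx => by
    obtain ⟨a, ha, rfl⟩ := List.mem_map.1 hx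
    exact h a ha

variable {L : ℕ} [NeZero L]

omit [NeZero L] in
theorem gate_sites_injective (hL : 2 ≤ L) (a : ZMod L) : Function.Injective ![a, a + 1] := by
  have : Fact (1 < L) := ⟨hL⟩
  intro x y h
  fin_cases x <;> fin_cases y <;> simp_all

theorem gateAt_mem_unitary (hL : 2 ≤ L) (a : ZMod L) (G : Gate) :
    gateAt a G ∈ unitary (Op (ZMod L)) :=
  embed_mem_unitary (gate_sites_injective hL a) G.2

theorem commute_gateAt {a b : ZMod L} (h1 : a ≠ b) (h2 : a ≠ b + 1) (h3 : a + 1 ≠ b) (G G' : Gate) :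
    Commute (gateAt a G) (gateAt b G') := by
  refine commute_embed (fun x y => ?_) _ _
  fin_cases x <;> fin_cases y <;> simp_all

/-- The positions `c, c + 2, c + 4, …` of the gates of a layer. -/
def layerSites (L c : ℕ) : List (ZMod L) :=
  List.ofFn fun k : Fin (L / 2) => ((2 * k.1 + c : ℕ) : ZMod L)

/-- A layer of the brickwork, with the same gate at all positions of the parity of `c`. -/
def layer (L : ℕ) [NeZero L] (c : ℕ) (G : Gate) : Op (ZMod L) :=
  ((layerSites L c).map fun a => gateAt a G).prod

omit [NeZero L] in
theorem mem_layerSites {c : ℕ} {a : ZMod L} :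
    a ∈ layerSites L c ↔ ∃ k < L / 2, ((2 * k + c : ℕ) : ZMod L) = a := by
  rw [layerSites, List.mem_ofFn]
  exact ⟨fun ⟨k, hk⟩ => ⟨k.1, k.2, hk⟩, fun ⟨k, hk, h⟩ => ⟨⟨k, hk⟩, h⟩⟩

theorem intCast_mem_layerSites (hL : Even L) {c : ℕ} {x : ℤ} :
    (x : ZMod L) ∈ layerSites L c ↔ Even (x - c) := by
  obtain ⟨h, hh⟩ := hL
  have hpos : 0 < L := Nat.pos_of_ne_zero (NeZero.ne L)
  rw [mem_layerSites]
  constructor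
  · rintro ⟨k, -, hk⟩
    have hk' : (((2 * k + c : ℕ) : ℤ) : ZMod L) = (x : ZMod L) := by exact_mod_cast hk
    rw [ZMod.intCast_eq_intCast_iff_dvd_sub] at hk'
    obtain ⟨q, hq⟩ := hk'
    refine ⟨k + h * q, ?_⟩
    have : (L : ℤ) = h + h := by exact_mod_cast hh
    rw [this] at hq
    push_cast at hq
    linarith
  · rintro ⟨m, hm⟩
    have hhpos : (0 : ℤ) < h := by omega
    refine ⟨(m % h).toNat, ?_, ?_⟩
    · have h1 := Int.emod_lt_of_pos m hhpos
      have h2 := Int.emod_nonneg m hhpos.ne'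
      omega
    · have h2 := Int.emod_nonneg m hhpos.ne'
      have h3 := Int.emod_add_mul_ediv m h
      have : (((2 * (m % h).toNat + c : ℕ) : ℤ) : ZMod L) = (x : ZMod L) := by
        rw [ZMod.intCast_eq_intCast_iff_dvd_sub]
        refine ⟨m / h, ?_⟩
        push_cast
        rw [Int.toNat_of_nonneg h2, hh]
        push_cast
        linarith
      exact_mod_cast this

omit [NeZero L] in
theorem layerSites_nodup (L c : ℕ) : (layerSites L c).Nodup := by
  rw [layerSites, List.nodup_ofFn]
  rintro ⟨k, hk⟩ ⟨l, hl⟩ h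
  have h' : (((2 * k + c : ℕ) : ℤ) : ZMod L) = (((2 * l + c : ℕ) : ℤ) : ZMod L) := by
    exact_mod_cast h
  have : ((2 * k + c : ℕ) : ℤ) = ((2 * l + c : ℕ) : ℤ) :=
    intCast_injOn_Ico L c ⟨by omega, by omega⟩ ⟨by omega, by omega⟩ h'
  exact Fin.ext (by simp only; omega)

theorem commute_of_mem_layerSites (hL : Even L) {c : ℕ} {a b : ZMod L} (ha : a ∈ layerSites L c)
    (hb : b ∈ layerSites L c) (G : Gate) : Commute (gateAt a G) (gateAt b G) := by
  obtain ⟨x, -, -, rfl⟩ := exists_int_rep 0 a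
  obtain ⟨y, -, -, rfl⟩ := exists_int_rep 0 b
  by_cases hab : (x : ZMod L) = (y : ZMod L)
  · rw [hab]
  rw [intCast_mem_layerSites hL] at ha hb
  refine commute_gateAt hab (fun h => ?_) (fun h => ?_) G G
  · have h' : ((x : ℤ) : ZMod L) = ((y + 1 : ℤ) : ZMod L) := by
      rw [h]
      push_cast
      rfl
    have := (intCast_mem_layerSites hL (c := c)).1 (h' ▸ (intCast_mem_layerSites hL).2 ha)
    rw [Int.even_iff] at *
    omega
  · have h' : ((y : ℤ) : ZMod L) = ((x + 1 : ℤ) : ZMod L) := by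
      rw [← h]
      push_cast
      rfl
    have := (intCast_mem_layerSites hL (c := c)).1 (h' ▸ (intCast_mem_layerSites hL).2 hb)
    rw [Int.even_iff] at *
    omega

theorem layer_mem_unitary (hL : Even L) (c : ℕ) (G : Gate) :
    layer L c G ∈ unitary (Op (ZMod L)) := by
  have hL2 : 2 ≤ L := by
    have := NeZero.ne L
    obtain ⟨h, rfl⟩ := hL
    omega
  exact list_prod_mem_unitary _ fun a _ => gateAt_mem_unitary hL2 a G

/-- A list of gates inside a window is the embedding of an operator which does not depend on the
size of the ring. -/
theorem exists_embed_eq_prod_gateAt (j : ℤ) (r : ℕ) (G : Gate) (xs : List ℤ)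
    (hxs : ∀ x ∈ xs, j - r ≤ x ∧ x + 1 ≤ j + r) :
    ∃ B : Op (window j r), ∀ (L : ℕ) [NeZero L], 2 * r + 1 ≤ L →
      (xs.map fun x : ℤ => gateAt (x : ZMod L) G).prod = embed (windowMap j r L) B := by
  induction xs with
  | nil => exact ⟨1, fun L _ _ => by rw [embed_one]; rfl⟩
  | cons x xs ih =>
    obtain ⟨B, hB⟩ := ih fun y hy => hxs y (List.mem_cons_of_mem _ hy)
    obtain ⟨h1, h2⟩ := hxs x List.mem_cons_self
    refine ⟨embed ![⟨x, Finset.mem_Icc.2 ⟨h1, by omega⟩⟩,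
      ⟨x + 1, Finset.mem_Icc.2 ⟨by omega, h2⟩⟩] (G : Op (Fin 2)) * B, fun L _ hL => ?_⟩
    have hinj := windowMap_injective (j := j) hL
    rw [List.map_cons, List.prod_cons, hB L hL, embed_mul hinj, embed_embed hinj, gateAt]
    congr 2
    funext k
    fin_cases k <;> simp [windowMap]

/-- A layer splits into the gates inside the window of radius `r + 1` and gates which do not meet
the window of radius `r`. -/
theorem exists_layer_eq_mul (j : ℤ) (r c : ℕ) (G : Gate) :
    ∃ B : Op (window j (r + 1)), ∀ (L : ℕ) [NeZero L], Even L → 2 * (r + 1) + 1 ≤ L →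
      ∃ D ∈ unitary (Op (ZMod L)),
        layer L c G = embed (windowMap j (r + 1) L) B * D ∧
        layer L c G = D * embed (windowMap j (r + 1) L) B ∧
        ∀ A : Op (window j r), Commute D (embed (windowMap j r L) A) := by
  classical
  set xs : List ℤ := ((Finset.Ico (j - (r + 1)) (j + r + 1)).filter
    fun x : ℤ => Even (x - c)).toList
    with hxs
  have hmem : ∀ x, x ∈ xs ↔ (j - (r + 1) ≤ x ∧ x < j + r + 1) ∧ Even (x - c) := fun x => by
    rw [hxs, Finset.mem_toList, Finset.mem_filter, Finset.mem_Ico]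
  obtain ⟨B, hB⟩ := exists_embed_eq_prod_gateAt j (r + 1) G xs fun x hx => by
    have := ((hmem x).1 hx).1
    push_cast
    omega
  refine ⟨B, fun L _ hL hrL => ?_⟩
  set ms : List (ZMod L) := xs.map fun x : ℤ => (x : ZMod L) with hms
  set rest := (layerSites L c).filter fun a => decide (a ∉ ms) with hrest
  have hsub : ∀ a ∈ ms, a ∈ layerSites L c := by
    intro a ha
    obtain ⟨x, hx, rfl⟩ := List.mem_map.1 ha
    exact (intCast_mem_layerSites hL).2 ((hmem x).1 hx).2
  have hnodup : ms.Nodup := by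
    refine List.Nodup.map_on (fun x hx y hy h => ?_) (Finset.nodup_toList _)
    have h1 := ((hmem x).1 hx).1
    have h2 := ((hmem y).1 hy).1
    exact intCast_injOn_Ico L (j - (r + 1)) ⟨h1.1, by omega⟩ ⟨h2.1, by omega⟩ h
  have hperm : (layerSites L c).Perm (ms ++ rest) := by
    have h1 := List.filter_append_perm (fun a => decide (a ∈ ms)) (layerSites L c)
    have h2 : ((layerSites L c).filter fun a => decide (a ∈ ms)).Perm ms := by
      rw [List.perm_ext_iff_of_nodup ((layerSites_nodup L c).filter _) hnodup]
      intro a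
      simp only [List.mem_filter, decide_eq_true_eq]
      exact ⟨fun h => h.2, fun h => ⟨hsub a h, h⟩⟩
    refine h1.symm.trans ?_
    have h3 : (layerSites L c).filter (fun a => !decide (a ∈ ms)) = rest := by
      rw [hrest]
      congr 1
      funext a
      simp
    rw [h3]
    exact h2.append_right _
  have hprod : ∀ l, (layerSites L c).Perm l → layer L c G = (l.map fun a => gateAt a G).prod := by
    intro l hl
    refine (hl.map _).prod_eq' ?_
    rw [List.pairwise_map]
    exact List.Pairwise.imp_of_mem (fun ha hb _ => commute_of_mem_layerSites hL ha hb G)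
      (layerSites_nodup L c)
  have hBL : (ms.map fun a => gateAt a G).prod = embed (windowMap j (r + 1) L) B := by
    rw [← hB L hrL, hms, List.map_map]
    rfl
  refine ⟨(rest.map fun a => gateAt a G).prod, ?_, ?_, ?_, ?_⟩
  · exact list_prod_mem_unitary _ fun a _ => gateAt_mem_unitary (by omega) a G
  · rw [hprod _ hperm, List.map_append, List.prod_append, hBL]
  · rw [hprod _ (hperm.trans List.perm_append_comm), List.map_append, List.prod_append, hBL]
  · intro A
    refine Commute.list_prod_left _ _ fun D hD => ?_
    obtain ⟨a, ha, rfl⟩ := List.mem_map.1 hD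
    rw [hrest, List.mem_filter, decide_eq_true_eq] at ha
    refine commute_embed (fun k y h => ha.2 ?_) _ _
    have hy := Finset.mem_Icc.1 y.2
    -- a gate of the layer that meets the inner window lies in the outer one
    rw [hms, List.mem_map]
    fin_cases k
    · have h' : (y.1 : ZMod L) = a := h.symm
      refine ⟨y.1, (hmem _).2 ⟨by omega, ?_⟩, h'⟩
      rw [← intCast_mem_layerSites hL, h']
      exact ha.1
    · have h' : ((y.1 - 1 : ℤ) : ZMod L) = a := by
        have : a + 1 = (y.1 : ZMod L) := h
        push_cast
        rw [← this]
        ring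
      refine ⟨y.1 - 1, (hmem _).2 ⟨by omega, ?_⟩, h'⟩
      rw [← intCast_mem_layerSites hL, h']
      exact ha.1

end Layers

/-! ### Light cones -/

section LightCone

/-- A family of operators on the rings of even size which, on all rings into which the window of
radius `r` fits, is given by the same operator on that window. -/
def IsWindowLocal (j : ℤ) (r : ℕ) (A : ∀ (L : ℕ) [NeZero L], Op (ZMod L)) : Prop :=
  ∃ B : Op (window j r), ∀ (L : ℕ) [NeZero L], Even L → 2 * r + 1 ≤ L →
    A L = embed (windowMap j r L) B

theorem IsWindowLocal.mono {j : ℤ} {r r' : ℕ} {A : ∀ (L : ℕ) [NeZero L], Op (ZMod L)}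
    (hA : IsWindowLocal j r A) (h : r ≤ r') : IsWindowLocal j r' A := by
  obtain ⟨B, hB⟩ := hA
  refine ⟨embed (fun x : window j r => ⟨x.1, Finset.mem_Icc.2
    (by have := Finset.mem_Icc.1 x.2; omega)⟩) B, fun L _ hL hr => ?_⟩
  rw [hB L hL (by omega), embed_embed (windowMap_injective hr)]
  rfl

theorem isWindowLocal_single (j : ℤ) (O : Op Unit) :
    IsWindowLocal j 0 fun L _ => single (j : ZMod L) O :=
  ⟨_, fun _ _ _ hL => single_eq_embed_windowMap j hL O⟩

/-- Conjugation by a layer increases the radius of the support by one: the gates which do not meet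
the support cancel, and the other ones lie in the larger window. -/
theorem IsWindowLocal.conj_layer {j : ℤ} {r : ℕ} {A : ∀ (L : ℕ) [NeZero L], Op (ZMod L)}
    (hA : IsWindowLocal j r A) (c : ℕ) (G : Gate) :
    IsWindowLocal j (r + 1) fun L _ => (layer L c G).conjTranspose * A L * layer L c G := by
  obtain ⟨B, hB⟩ := hA.mono (Nat.le_succ r)
  obtain ⟨A', hA'⟩ := hA
  obtain ⟨W, hW⟩ := exists_layer_eq_mul j r c G
  refine ⟨W.conjTranspose * B * W, fun L _ hL hr => ?_⟩
  obtain ⟨D, hD, -, hlayer, hcomm⟩ := hW L hL hr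
  change (layer L c G).conjTranspose * A L * layer L c G = _
  have hinj := windowMap_injective (j := j) hr
  have hDA : D.conjTranspose * A L * D = A L := by
    rw [hA' L hL (by omega), Matrix.mul_assoc, ← (hcomm A').eq, ← Matrix.mul_assoc]
    have : D.conjTranspose * D = 1 := (Unitary.mem_iff.1 hD).1
    rw [this, Matrix.one_mul]
  rw [embed_mul hinj, embed_mul hinj, embed_conjTranspose, ← hB L hL hr, hlayer,
    Matrix.conjTranspose_mul]
  conv_rhs => rw [← hDA]
  simp only [Matrix.mul_assoc]

theorem IsWindowLocal.conj_layer' {j : ℤ} {r : ℕ} {A : ∀ (L : ℕ) [NeZero L], Op (ZMod L)}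
    (hA : IsWindowLocal j r A) (c : ℕ) (G : Gate) :
    IsWindowLocal j (r + 1) fun L _ => layer L c G * A L * (layer L c G).conjTranspose := by
  obtain ⟨B, hB⟩ := hA.mono (Nat.le_succ r)
  obtain ⟨A', hA'⟩ := hA
  obtain ⟨W, hW⟩ := exists_layer_eq_mul j r c G
  refine ⟨W * B * W.conjTranspose, fun L _ hL hr => ?_⟩
  obtain ⟨D, hD, hlayer, -, hcomm⟩ := hW L hL hr
  change layer L c G * A L * (layer L c G).conjTranspose = _
  have hinj := windowMap_injective (j := j) hr
  have hDA : D * A L * D.conjTranspose = A L := by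
    rw [hA' L hL (by omega), (hcomm A').eq, Matrix.mul_assoc]
    have : D * D.conjTranspose = 1 := (Unitary.mem_iff.1 hD).2
    rw [this, Matrix.mul_one]
  rw [embed_mul hinj, embed_mul hinj, embed_conjTranspose, ← hB L hL hr, hlayer,
    Matrix.conjTranspose_mul]
  conv_rhs => rw [← hDA]
  simp only [Matrix.mul_assoc]

/-- The product of the layers with the given parities and gates. -/
def circuit (Ls : List (ℕ × Gate)) (L : ℕ) [NeZero L] : Op (ZMod L) :=
  (Ls.map fun p => layer L p.1 p.2).prod

theorem circuit_mem_unitary (Ls : List (ℕ × Gate)) {L : ℕ} [NeZero L] (hL : Even L) :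
    circuit Ls L ∈ unitary (Op (ZMod L)) :=
  list_prod_mem_unitary _ fun p _ => layer_mem_unitary hL p.1 p.2

theorem IsWindowLocal.conj_circuit {j : ℤ} (Ls : List (ℕ × Gate)) :
    ∀ {r : ℕ} {A : ∀ (L : ℕ) [NeZero L], Op (ZMod L)}, IsWindowLocal j r A →
      IsWindowLocal j (r + Ls.length)
        fun L _ => (circuit Ls L).conjTranspose * A L * circuit Ls L := by
  induction Ls with
  | nil =>
    intro r A hA
    simpa [circuit] using hA
  | cons p Ls ih =>
    intro r A hA
    have h := ih (hA.conj_layer p.1 p.2)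
    rw [List.length_cons, add_comm Ls.length, ← add_assoc]
    simpa only [circuit, List.map_cons, List.prod_cons, Matrix.conjTranspose_mul,
      Matrix.mul_assoc] using h

theorem IsWindowLocal.conj_circuit' {j : ℤ} {r : ℕ} {A : ∀ (L : ℕ) [NeZero L], Op (ZMod L)}
    (hA : IsWindowLocal j r A) (Ls : List (ℕ × Gate)) :
    IsWindowLocal j (r + Ls.length)
      fun L _ => circuit Ls L * A L * (circuit Ls L).conjTranspose := by
  induction Ls with
  | nil => simpa [circuit] using hA
  | cons p Ls ih =>
    have h := ih.conj_layer' p.1 p.2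
    rw [List.length_cons, ← add_assoc]
    simpa only [circuit, List.map_cons, List.prod_cons, Matrix.conjTranspose_mul,
      Matrix.mul_assoc] using h

theorem IsWindowLocal.trace_mul_eq {j : ℤ} {r : ℕ} {A B : ∀ (L : ℕ) [NeZero L], Op (ZMod L)}
    (hA : IsWindowLocal j r A) (hB : IsWindowLocal j r B) {L L' : ℕ} [NeZero L] [NeZero L']
    (hL : Even L) (hL' : Even L') (hr : 2 * r + 1 ≤ L) (hr' : 2 * r + 1 ≤ L') :
    (A L * B L).trace / 2 ^ Fintype.card (ZMod L) =
      (A L' * B L').trace / 2 ^ Fintype.card (ZMod L') := by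
  obtain ⟨a, ha⟩ := hA
  obtain ⟨b, hb⟩ := hB
  rw [ha L hL hr, hb L hL hr, ha L' hL' hr', hb L' hL' hr', ← embed_mul (windowMap_injective hr),
    ← embed_mul (windowMap_injective hr'), trace_embed (windowMap_injective hr),
    trace_embed (windowMap_injective hr')]

/-- The correlation of an operator in a window of radius `R` with a one-site operator conjugated by
a circuit of depth `m` does not depend on the size of the ring. Since the first layers may be moved
to one operator and the last layers to the other, the ring only has to contain a window of half the
size of the sum of the two light cones. -/
theorem trace_mul_conj_circuit_eq {j : ℤ} {R : ℕ} {A : ∀ (L : ℕ) [NeZero L], Op (ZMod L)}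
    (hA : IsWindowLocal j R A) (O : Op Unit) (Ls : List (ℕ × Gate)) (hR : R ≤ Ls.length)
    {L L' : ℕ} [NeZero L] [NeZero L'] (hL : Even L) (hL' : Even L')
    (h : R + Ls.length + 2 ≤ L) (h' : R + Ls.length + 2 ≤ L') :
    (A L * ((circuit Ls L).conjTranspose * single (j : ZMod L) O * circuit Ls L)).trace /
        2 ^ Fintype.card (ZMod L) =
      (A L' * ((circuit Ls L').conjTranspose * single (j : ZMod L') O * circuit Ls L')).trace /
        2 ^ Fintype.card (ZMod L') := by
  set ρ := (R + Ls.length + 1) / 2 with hρ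
  have h1 := ((isWindowLocal_single j O).conj_circuit (Ls.take ρ)).mono
    (show 0 + (Ls.take ρ).length ≤ ρ by rw [List.length_take]; omega)
  have h2 := (hA.conj_circuit' (Ls.drop ρ)).mono
    (show R + (Ls.drop ρ).length ≤ ρ by rw [List.length_drop]; omega)
  have key := h2.trace_mul_eq h1 hL hL' (by omega) (by omega)
  have hsplit : ∀ (L : ℕ) [NeZero L],
      circuit Ls L = circuit (Ls.take ρ) L * circuit (Ls.drop ρ) L := by
    intro L _
    rw [circuit, circuit, circuit, ← List.prod_append, ← List.map_append, List.take_append_drop]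
  have hcyc : ∀ (L : ℕ) [NeZero L],
      (A L * ((circuit Ls L).conjTranspose * single (j : ZMod L) O * circuit Ls L)).trace =
      (circuit (Ls.drop ρ) L * A L * (circuit (Ls.drop ρ) L).conjTranspose *
        ((circuit (Ls.take ρ) L).conjTranspose * single (j : ZMod L) O *
          circuit (Ls.take ρ) L)).trace := by
    intro L _
    rw [hsplit L, Matrix.conjTranspose_mul]
    simp only [Matrix.mul_assoc]
    rw [Matrix.trace_mul_comm (circuit (Ls.drop ρ) L)]
    simp only [Matrix.mul_assoc]
  rw [hcyc, hcyc]
  exact key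

/-- The `2 d` layers of the brickwork ansatz: `c = 2` stands for the positions `2, 4, …` and `c = 1`
for `1, 3, …`. -/
def ansatzLayers {P : Type*} (V : P → Gate) {d : ℕ} (θ : Fin d → P × P) : List (ℕ × Gate) :=
  (List.ofFn fun i => [(2, V (θ i).1), (1, V (θ i).2)]).flatten

theorem length_ansatzLayers {P : Type*} (V : P → Gate) {d : ℕ} (θ : Fin d → P × P) :
    (ansatzLayers V θ).length = 2 * d := by
  simp [ansatzLayers, List.length_flatten, List.map_ofFn, Function.comp_def, mul_comm]

theorem ansatz_eq_circuit {P : Type*} (V : P → Gate) {d : ℕ} (θ : Fin d → P × P) (L : ℕ)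
    [NeZero L] : ansatz V θ L = circuit (ansatzLayers V θ) L := by
  rw [circuit, ansatzLayers, List.map_flatten, List.prod_flatten, List.map_ofFn, List.map_ofFn,
    ansatz]
  congr 2
  funext i
  simp [layer, layerSites, List.map_ofFn, Function.comp_def, mul_add]

end LightCone

/-! ### Comparison of rings of different sizes -/

section Compilation

variable {L : ℕ} [NeZero L]

theorem sum_range_mul_eq (f : ZMod L → ℝ) (M : ℕ) :
    ∑ x ∈ Finset.range (M * L), f (x : ZMod L) = M * ∑ a, f a := by
  have hL : ∑ x ∈ Finset.range L, f (x : ZMod L) = ∑ a, f a := by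
    refine Finset.sum_nbij (fun x : ℕ => (x : ZMod L)) (by simp) ?_ ?_ (by simp)
    · intro x hx y hy h
      have hx' := Finset.mem_range.1 (Finset.mem_coe.1 hx)
      have hy' := Finset.mem_range.1 (Finset.mem_coe.1 hy)
      have : ((x : ℤ) : ZMod L) = ((y : ℤ) : ZMod L) := by exact_mod_cast h
      have : (x : ℤ) = y :=
        intCast_injOn_Ico L 0 ⟨by omega, by omega⟩ ⟨by omega, by omega⟩ this
      exact_mod_cast this
    · intro a _
      exact ⟨a.val, by simpa using ZMod.val_lt a, by simp⟩
  induction M with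
  | zero => simp
  | succ M ih =>
    rw [Nat.succ_mul, Finset.sum_range_add, ih]
    have : ∀ x : ℕ, ((M * L + x : ℕ) : ZMod L) = x := fun x => by simp
    simp only [this, hL]
    push_cast
    ring

/-- Averages over two rings may be compared on a common multiple of the two periods. -/
theorem costLHST_le_of_forall_site {L L' : ℕ} [NeZero L] [NeZero L'] {U V : Op (ZMod L)}
    {U' V' : Op (ZMod L')} {δ : ℝ}
    (h : ∀ j : ℤ, costLHSTAt (j : ZMod L) U V ≤ costLHSTAt (j : ZMod L') U' V' + δ) :
    costLHST U V ≤ costLHST U' V' + δ := by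
  have hpos : (0 : ℝ) < L := by exact_mod_cast Nat.pos_of_ne_zero (NeZero.ne L)
  have hpos' : (0 : ℝ) < L' := by exact_mod_cast Nat.pos_of_ne_zero (NeZero.ne L')
  have e1 := sum_range_mul_eq (fun a : ZMod L => costLHSTAt a U V) L'
  have e2 := sum_range_mul_eq (fun a : ZMod L' => costLHSTAt a U' V') L
  rw [mul_comm L L'] at e2
  have hle : ∑ x ∈ Finset.range (L' * L), costLHSTAt (x : ZMod L) U V ≤
      ∑ x ∈ Finset.range (L' * L), (costLHSTAt (x : ZMod L') U' V' + δ) :=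
    Finset.sum_le_sum fun x _ => by exact_mod_cast h x
  rw [Finset.sum_add_distrib, e1, e2, Finset.sum_const, Finset.card_range, nsmul_eq_mul] at hle
  push_cast at hle
  rw [costLHST, costLHST, ZMod.card, ZMod.card]
  refine le_of_mul_le_mul_left ?_ (mul_pos hpos' hpos)
  calc L' * L * (1 / L * ∑ j, costLHSTAt j U V) = L' * ∑ j, costLHSTAt j U V := by
        field_simp
    _ ≤ L * ∑ j, costLHSTAt j U' V' + L' * L * δ := hle
    _ = L' * L * (1 / L' * ∑ j, costLHSTAt j U' V' + δ) := by field_simp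

/-- The restricted evolution of an observable, as a family of operators on all rings. -/
theorem isWindowLocal_restricted (Φ : Interaction) {L' : ℝ} (hL' : 0 ≤ L') (τ : ℝ) (j : ℤ)
    (O : Op Unit) :
    IsWindowLocal j ⌊L' / 2⌋₊ fun L _ => (evolution (Φ.hamRestricted L L' j) τ).conjTranspose *
      single (j : ZMod L) O * evolution (Φ.hamRestricted L L' j) τ := by
  refine ⟨(evolution (windowHam Φ j ⌊L' / 2⌋₊) τ).conjTranspose *
    embed (fun _ : Unit => ⟨j, self_mem_window j ⌊L' / 2⌋₊⟩) O *
      evolution (windowHam Φ j ⌊L' / 2⌋₊) τ, fun L _ _ hr => ?_⟩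
  dsimp only
  rw [hamRestricted_eq_embed Φ hL' j hr]
  exact conj_evolution_window Φ hr j O τ

theorem target_mem_unitary (Φ : Interaction) (dH : ℕ) (τ : ℝ) :
    Φ.target dH τ L ∈ unitary (Op (ZMod L)) :=
  evolution_mem_unitary (hamPBC_isHermitian Φ dH L) τ

/-- The local costs at a site in two rings differ by the restriction errors of the two rings, since
the restricted evolution and the light cone of the circuit fit into both. -/
theorem costLHSTAt_circuit_le {Φ : Interaction} {dH : ℕ} {τ L' ε : ℝ} (hL' : 0 ≤ L')
    (hε : Φ.RestrictionErrorLE dH τ L' ε) (Ls : List (ℕ × Gate)) (hLs : ⌊L' / 2⌋₊ ≤ Ls.length)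
    {M : ℕ} [NeZero M] (hL : Even L) (hM : Even M) (hLL' : L' + 1 ≤ L) (hML' : L' + 1 ≤ M)
    (hLd : ⌊L' / 2⌋₊ + Ls.length + 2 ≤ L) (hMd : ⌊L' / 2⌋₊ + Ls.length + 2 ≤ M) (j : ℤ) :
    costLHSTAt (j : ZMod L) (Φ.target dH τ L) (circuit Ls L) ≤
      costLHSTAt (j : ZMod M) (Φ.target dH τ M) (circuit Ls M) + 3 / 2 * ε := by
  have happrox : ∀ (N : ℕ) [NeZero N], Even N → L' + 1 ≤ N →
      |costLHSTAt (j : ZMod N) (Φ.target dH τ N) (circuit Ls N) - (1 - 1 / 4 * ∑ c,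
        ((((evolution (Φ.hamRestricted N L' j) τ).conjTranspose * single (j : ZMod N) (pauliOp c) *
          evolution (Φ.hamRestricted N L' j) τ) * ((circuit Ls N).conjTranspose *
            single (j : ZMod N) (pauliOp c) * circuit Ls N)).trace /
              2 ^ Fintype.card (ZMod N)).re)| ≤ 3 / 4 * ε := by
    intro N _ hN hNL'
    refine abs_costLHSTAt_sub_le (j : ZMod N) (circuit_mem_unitary Ls hN) (fun c =>
      (evolution (Φ.hamRestricted N L' j) τ).conjTranspose * single (j : ZMod N) (pauliOp c) *
        evolution (Φ.hamRestricted N L' j) τ) ?_ fun c _ => ?_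
    · have h1 := (Unitary.mem_iff.1 (target_mem_unitary (L := N) Φ dH τ)).1
      have h2 := (Unitary.mem_iff.1
        (evolution_mem_unitary (hamRestricted_isHermitian Φ N L' j) τ)).1
      rw [Matrix.star_eq_conjTranspose] at h1 h2
      simp only [single_pauliOp_zero, Matrix.mul_one]
      rw [h1, h2]
    · exact hε N hNL' j (pauliOp c) (isNormalizedObservable_pauliOp c)
  have h1 := happrox L hL hLL'
  have h2 := happrox M hM hML'
  have heq : ∀ c, _ = _ := fun c => trace_mul_conj_circuit_eq
    (isWindowLocal_restricted Φ hL' τ j (pauliOp c)) (pauliOp c) Ls hLs hL hM hLd hMd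
  simp only [heq] at h1
  rw [abs_le] at h1 h2
  linarith [h1.2, h2.1]

end Compilation

end

end LVQC

open LVQC
theorem theorem1 (g : ℝ) (k dH : ℕ) :
    -- a Lieb-Robinson velocity `v` and length `ξ`, depending on `g`, `k`, `dH` only, exist
    (∃ v ξ : ℝ, 0 < v ∧ 0 < ξ ∧ ∀ τ : ℝ, 0 ≤ τ → ∃ C : ℝ, LiebRobinsonBound g k dH v ξ τ C) ∧
    ∀ v ξ τ C : ℝ, 0 ≤ v → 0 < ξ → 0 ≤ τ → LiebRobinsonBound g k dH v ξ τ C →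
      -- `ε_LR`, with a prefactor `C'` independent of the sizes, bounds the restriction error
      (∃ C' : ℝ, 0 ≤ C' ∧ ∀ Φ : Interaction, Φ.IsLocal g k dH → ∀ l₀ : ℝ, 0 ≤ l₀ →
        Φ.RestrictionErrorLE dH τ (restrictionSize dH v τ l₀) (epsLR dH v ξ τ l₀ C')) ∧
      -- local compilation, for every such `ε_LR`
      ∀ (C' : ℝ) (Φ : Interaction), Φ.IsLocal g k dH → ∀ l₀ : ℝ, 0 ≤ l₀ →
        Φ.RestrictionErrorLE dH τ (restrictionSize dH v τ l₀) (epsLR dH v ξ τ l₀ C') →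
        ∀ (d : ℕ) (d' : ℝ), 0 ≤ d' → (d : ℝ) = restrictionSize dH v τ l₀ / 4 + d' →
        ∀ (P : Type*) (V : P → Gate) (Lt : ℕ) [NeZero Lt],
          IsLeast {n : ℕ | Even n ∧ 2 * (l₀ + dH + v * τ) + 2 * d' + 1 < (n : ℝ)} Lt →
        ∀ (α : ℝ), α ∈ Set.Icc (0 : ℝ) 1 → ∀ θopt : Fin d → P × P,
          (∀ θ : Fin d → P × P,
            costAlpha α (Φ.target dH τ Lt) (ansatz V θopt Lt) ≤
              costAlpha α (Φ.target dH τ Lt) (ansatz V θ Lt)) →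
        ∀ εLHST εHST : ℝ,
          costLHST (Φ.target dH τ Lt) (ansatz V θopt Lt) < εLHST →
          costHST (Φ.target dH τ Lt) (ansatz V θopt Lt) < εHST →
        ∀ (L : ℕ) [NeZero L], Even L → Lt ≤ L →
          costLHST (Φ.target dH τ L) (ansatz V θopt L) ≤
              εLHST + 3 / 2 * epsLR dH v ξ τ l₀ C' ∧
          costHST (Φ.target dH τ L) (ansatz V θopt L) ≤
              L * (εHST + 3 / 2 * epsLR dH v ξ τ l₀ C') := by
  refine ⟨⟨_, 1, by positivity, one_pos, fun τ hτ => ⟨_, liebRobinsonBound g k dH hτ⟩⟩, ?_⟩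
  intro v ξ τ C hv hξ hτ _
  refine ⟨restrictionErrorLE g k dH hv hξ hτ, ?_⟩
  intro C' Φ _ l₀ hl₀ hε d d' hd' hd P V Lt _ hLt α _ θ _ εL εH hεL hεH L _ hL hLtL
  set ε := epsLR dH v ξ τ l₀ C'
  set L' := restrictionSize dH v τ l₀ with hL'
  have hvτ : 0 ≤ v * τ := mul_nonneg hv hτ
  have hL'eq : L' = 2 * (l₀ + dH + v * τ) := rfl
  have hL'0 : 0 ≤ L' := by
    rw [hL'eq]
    positivity
  obtain ⟨hLteven, hLtgt⟩ := hLt.1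
  rw [← hL'eq] at hLtgt
  have hfloor : (⌊L' / 2⌋₊ : ℝ) ≤ L' / 2 := Nat.floor_le (by positivity)
  have hLtL' : (Lt : ℝ) ≤ L := by exact_mod_cast hLtL
  have hlen : ⌊L' / 2⌋₊ ≤ (ansatzLayers V θ).length := by
    rw [length_ansatzLayers]
    have : (⌊L' / 2⌋₊ : ℝ) ≤ (2 * d : ℕ) := by
      push_cast
      linarith
    exact_mod_cast this
  -- `L̃ > L' + 2 d' + 1 = L' / 2 + 2 d + 1` for the `2 d` layers of the ansatz
  have hfit : ⌊L' / 2⌋₊ + (ansatzLayers V θ).length + 2 ≤ Lt := by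
    rw [length_ansatzLayers]
    have : ((⌊L' / 2⌋₊ + 2 * d + 1 : ℕ) : ℝ) < Lt := by
      push_cast
      linarith
    have := Nat.cast_lt.1 this
    omega
  have hlocal : costLHST (Φ.target dH τ L) (ansatz V θ L) ≤
      costLHST (Φ.target dH τ Lt) (ansatz V θ Lt) + 3 / 2 * ε := by
    refine costLHST_le_of_forall_site fun j => ?_
    rw [ansatz_eq_circuit, ansatz_eq_circuit]
    exact costLHSTAt_circuit_le hL'0 hε (ansatzLayers V θ) hlen hL hLteven (by linarith)
      (by linarith) (hfit.trans hLtL) hfit j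
  have hVL : ansatz V θ L ∈ unitary (Op (ZMod L)) := by
    rw [ansatz_eq_circuit]
    exact circuit_mem_unitary _ hL
  refine ⟨by linarith, ?_⟩
  have hglobal := costHST_le_card_mul_costLHST (target_mem_unitary Φ dH τ) hVL
  rw [ZMod.card] at hglobal
  refine hglobal.trans (mul_le_mul_of_nonneg_left ?_ (Nat.cast_nonneg L))
  linarith [costLHST_le_costHST (Φ.target dH τ Lt) (ansatz V θ Lt)]
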